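/- Multiple-processor multitask scheduling (MPMS): there are $N\ge 2$ identical machines and a finite nonempty family of jobs arriving online; job $i$ is released at time $r_i\ge 0$ and consists of $n_i\ge1$ tasks with processing times $p_{i,\ell}>0$, each task being either preemptive or non-preemptive (a non-preemptive task, once started, runs on its machine to completion without interruption). A machine processes at most one task at a time, a task is processed on at most one machine at a time, and different tasks of one job may be processed in parallel. All information about job $i$ is unknown before $r_i$ and known from then on. The completion time $C_i$ of job $i$ is the maximum of the completion times of its tasks, and the cost is the total response time $\sum_i (C_i-r_i)$. With $p_i=\sum_\ell p_{i,\ell}$, let $\alpha=\max_i p_i/\min_i p_i$, let $\eta$ be the maximum processing time of a non-preemptive task ($\eta=0$ if there is none), and let $\beta=\eta/\min_i p_i$; thus $\alpha\ge 1$ and $0\le\beta\le\alpha$. A (deterministic) online algorithm is work-conserving if, whenever some machine is idle, every released unfinished task is being processed. For an online algorithm $\mathcal A$ on $N$ machines let $\mathcal{CR}_{\mathcal A}(\alpha,\beta)$ be the supremum, over all instances with parameters $\alpha$ and $\beta$, of the ratio of the cost of $\mathcal A$ to the optimal offline cost (the infimum of the cost over all feasible schedules on $N$ machines). Proposition. Every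 work-conserving algorithm for MPMS has competitive ratio $\Omega(\ln\alpha+\beta^{1-\varepsilon})$ for every $\varepsilon>0$. That is: for every $\varepsilon>0$ there is a constant $c>0$, depending only on $\varepsilon$, such that for every $N\ge 2$, every work-conserving online algorithm $\mathcal A$ on $N$ machines, and all real $\alpha\ge 1$ and $0\le\beta\le\alpha$ (with $\beta\ge 1$ in case $\varepsilon>1$), $$\mathcal{CR}_{\mathcal A}(\alpha,\beta)\ \ge\ c\,\bigl(\ln\alpha+\beta^{1-\varepsilon}\bigr).$$ -/

import Mathlib

open MeasureTheory

noncomputable section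

namespace MPMS

/-- A task: its processing time, and whether it may be interrupted. -/
structure Task where
  size : ℝ
  size_pos : 0 < size
  preemptive : Bool

/-- A job: its release date and its (nonempty) list of tasks. -/
structure Job where
  release : ℝ
  release_nonneg : 0 ≤ release
  tasks : List Task
  tasks_ne_nil : tasks ≠ []

/-- The workload of a job is the total processing time of its tasks. -/
def Job.workload (J : Job) : ℝ := (J.tasks.map Task.size).sum

/-- An input instance: a nonempty finite family of jobs, numbered in the order of release
(so that the number of a job reveals nothing about jobs that are released later). -/
structure Instance where
  jobs : List Job
  jobs_ne_nil : jobs ≠ []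
  sorted : jobs.Pairwise (fun J J' => J.release ≤ J'.release)

/-- `ω.HasTask τ J T`: task number `τ.2` of job number `τ.1` of the instance is `T`, and that job
is `J`. -/
def Instance.HasTask (ω : Instance) (τ : ℕ × ℕ) (J : Job) (T : Task) : Prop :=
  ω.jobs[τ.1]? = some J ∧ J.tasks[τ.2]? = some T

/-- The maximum job workload. -/
def Instance.maxWorkload (ω : Instance) : ℝ :=
  sSup {x | ∃ J ∈ ω.jobs, x = J.workload}

/-- The minimum job workload. -/
def Instance.minWorkload (ω : Instance) : ℝ :=
  sInf {x | ∃ J ∈ ω.jobs, x = J.workload}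

/-- The maximum processing time `η` of a non-preemptive task (`0` if there is none). -/
def Instance.eta (ω : Instance) : ℝ :=
  sSup {x | ∃ J ∈ ω.jobs, ∃ T ∈ J.tasks, T.preemptive = false ∧ x = T.size}

/-- The parameter `α`: ratio of the maximum to the minimum job workload. -/
def Instance.alpha (ω : Instance) : ℝ := ω.maxWorkload / ω.minWorkload

/-- The parameter `β`: ratio of `η` to the minimum job workload. -/
def Instance.beta (ω : Instance) : ℝ := ω.eta / ω.minWorkload

/-- A schedule on `N` machines: `σ m t` is the task that machine `m` is processing at time `t`
(`none` if the machine is idle); tasks are named by job number and task number. -/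
abbrev Schedule (N : ℕ) : Type := Fin N → ℝ → Option (ℕ × ℕ)

/-- The task `τ` is being processed at time `t`. -/
def Schedule.Runs {N : ℕ} (σ : Schedule N) (τ : ℕ × ℕ) (t : ℝ) : Prop :=
  ∃ m, σ m t = some τ

/-- The amount of processing that task `τ` has received before time `t`. -/
def Schedule.work {N : ℕ} (σ : Schedule N) (τ : ℕ × ℕ) (t : ℝ) : ℝ :=
  volume.real {s | 0 ≤ s ∧ s < t ∧ σ.Runs τ s}

/-- The schedules that are admissible for an instance. Different tasks of one job may be processed
in parallel; a preemptive task may be interrupted and resumed, on any machine. -/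
structure Feasible {N : ℕ} (ω : Instance) (σ : Schedule N) : Prop where
  measurable : ∀ m τ, MeasurableSet {t | σ m t = some τ}
  /-- Only tasks of released jobs are processed. -/
  released : ∀ m τ t, σ m t = some τ → ∃ J T, ω.HasTask τ J T ∧ J.release ≤ t
  /-- A task is on at most one machine at a time. -/
  sequential : ∀ m m' τ t, σ m t = some τ → σ m' t = some τ → m = m'
  /-- A completed task occupies no machine. -/
  unfinished : ∀ m τ t J T, ω.HasTask τ J T → σ m t = some τ → σ.work τ t < T.size
  /-- Every task is completed eventually. -/
  complete : ∀ τ J T, ω.HasTask τ J T → ∃ t, σ.work τ t = T.size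
  /-- Once started, a non-preemptive task is run to completion on its machine. -/
  nonpreemptive : ∀ τ J T, ω.HasTask τ J T → T.preemptive = false →
    ∃ m s, ∀ m' t, σ m' t = some τ ↔ m' = m ∧ s ≤ t ∧ t < s + T.size

/-- The completion time of task `ℓ` of job `i`. -/
def taskCompletion {N : ℕ} (ω : Instance) (σ : Schedule N) (i : Fin ω.jobs.length)
    (ℓ : Fin ω.jobs[i].tasks.length) : ℝ :=
  sInf {t | σ.work (i, ℓ) t = ω.jobs[i].tasks[ℓ].size}

/-- The completion time of a job is the maximum of the completion times of its tasks. -/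
def jobCompletion {N : ℕ} (ω : Instance) (σ : Schedule N) (i : Fin ω.jobs.length) : ℝ :=
  ⨆ ℓ : Fin ω.jobs[i].tasks.length, taskCompletion ω σ i ℓ

/-- The cost of a schedule: the total response time. -/
def totalResponse {N : ℕ} (ω : Instance) (σ : Schedule N) : ℝ :=
  ∑ i : Fin ω.jobs.length, (jobCompletion ω σ i - ω.jobs[i].release)

/-- The optimal offline cost on `N` machines. -/
def optCost (N : ℕ) (ω : Instance) : ℝ :=
  sInf {x | ∃ σ : Schedule N, Feasible ω σ ∧ x = totalResponse ω σ}

/-- Two instances have the same jobs released up to (and including) time `t`. -/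
def AgreeUpTo (ω ω' : Instance) (t : ℝ) : Prop :=
  ∀ (i : ℕ) (J : Job), J.release ≤ t → (ω.jobs[i]? = some J ↔ ω'.jobs[i]? = some J)

/-- A deterministic online algorithm on `N` machines: it produces an admissible schedule for every
instance, and what it does up to time `t` depends only on the jobs released up to time `t`. -/
structure OnlineAlgorithm (N : ℕ) where
  schedule : Instance → Schedule N
  feasible : ∀ ω, Feasible ω (schedule ω)
  causal : ∀ ω ω' t, AgreeUpTo ω ω' t → ∀ m, ∀ s ≤ t, schedule ω m s = schedule ω' m s

/-- A schedule is work-conserving if, whenever some machine is idle, no released and unfinished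
task is left waiting. -/
def WorkConservingSchedule {N : ℕ} (ω : Instance) (σ : Schedule N) : Prop :=
  ∀ t, (∃ m, σ m t = none) →
    ∀ τ J T, ω.HasTask τ J T → J.release ≤ t → σ.work τ t < T.size → σ.Runs τ t

/-- An algorithm is work-conserving if all its schedules are. -/
def OnlineAlgorithm.WorkConserving {N : ℕ} (A : OnlineAlgorithm N) : Prop :=
  ∀ ω, WorkConservingSchedule ω (A.schedule ω)

/-- The competitive ratio of an algorithm, as a function of the parameters `α` and `β`: the worst
ratio of its cost to the optimal offline cost, over all instances with these parameters. -/
def OnlineAlgorithm.competitiveRatio {N : ℕ} (A : OnlineAlgorithm N) (α β : ℝ) : EReal :=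
  ⨆ (ω : Instance) (_ : ω.alpha = α ∧ ω.beta = β),
    ((totalResponse ω (A.schedule ω) / optCost N ω : ℝ) : EReal)

end MPMS

end

/-!
All adversarial instances below end in a long stream of `N` unit jobs per time step. Such a stream
keeps all machines busy, so that the backlog of jobs of size at most `1` (or at most some `θ ≥ 1`)
never decreases during it. An algorithm that has `B` unfinished jobs throughout a stream of length
`L` pays about `B * L`, whereas an offline schedule that has finished all but `N` jobs before the
stream pays at most `2 * N * L` up to a constant, and so the competitive ratio is at least
`B / (2 * N)`. A single last job makes the parameters of the instance exactly `α` and `β`.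

*Linear growth in `β`.* At time `0` release `N` non-preemptive jobs of size `β`, followed by the
stream. A work-conserving algorithm starts all of them before time `1` and is then blocked until
time `β`, by which time about `N * β` unit jobs are waiting. The offline schedule postpones the `N`
long jobs to the end of the stream.

*Logarithmic growth in `α`.* Phase `j` lasts `2 * q j` and releases, at its start, `N * q j` unit
jobs and `N / 2` long jobs of size `2 * q j`; an offline schedule completes it in time. The numbers
`q j` decrease geometrically. If the algorithm has at least `N * q i / 12` unit work left halfway
through some phase `i`, the stream starts there: the offline schedule has completed the unit jobs
and postpones the `N / 2` long ones. Otherwise the algorithm has neglected the long jobs in every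
phase, and since the later phases are much shorter, after `k` phases its backlog of jobs of size at
most `2 * q i` is still at least `N * q i / 6`, for every `i < k`. Dividing by `2 * q i` and summing
over `i` gives each pending job a total weight of at most `2`, whence `N * k / 24` pending jobs.
There is room for about `log α` phases.
-/

noncomputable section

open scoped Finset List

namespace MPMS

variable {N : ℕ}

/-! ### Work and feasible schedules -/

namespace Schedule

theorem setOf_runs (σ : Schedule N) (τ : ℕ × ℕ) :
    {s | σ.Runs τ s} = ⋃ m, {s | σ m s = some τ} := by
  ext s
  simp [Runs]

theorem work_eq_measureReal_Ico_inter (σ : Schedule N) (τ : ℕ × ℕ) (t : ℝ) :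
    σ.work τ t = volume.real (Set.Ico 0 t ∩ {s | σ.Runs τ s}) := by
  unfold work
  congr 1
  ext s
  simp [and_assoc]

theorem work_nonneg (σ : Schedule N) (τ : ℕ × ℕ) (t : ℝ) : 0 ≤ σ.work τ t :=
  measureReal_nonneg

theorem work_sub_work (σ : Schedule N) (τ : ℕ × ℕ) {t t' : ℝ} (ht : 0 ≤ t) (h : t ≤ t') :
    σ.work τ t' - σ.work τ t = volume.real (Set.Ico t t' ∩ {s | σ.Runs τ s}) := by
  have hfinite (a b : ℝ) : volume.restrict {s | σ.Runs τ s} (Set.Ico a b) ≠ ⊤ :=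
    ne_top_of_le_ne_top (by simp) (Measure.restrict_apply_le _ _)
  have hunion := measureReal_union (Set.Ico_disjoint_Ico_same (a := 0) (b := t) (c := t'))
    measurableSet_Ico (hfinite 0 t) (hfinite t t')
  simp only [Set.Ico_union_Ico_eq_Ico ht h, measureReal_restrict_apply measurableSet_Ico]
    at hunion
  rw [work_eq_measureReal_Ico_inter, work_eq_measureReal_Ico_inter, hunion, add_sub_cancel_left]

theorem work_sub_work_le (σ : Schedule N) (τ : ℕ × ℕ) {t t' : ℝ} (ht : 0 ≤ t) (h : t ≤ t') :
    σ.work τ t' - σ.work τ t ≤ t' - t := by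
  rw [work_sub_work σ τ ht h]
  calc volume.real (Set.Ico t t' ∩ {s | σ.Runs τ s})
      ≤ volume.real (Set.Ico t t') := measureReal_mono Set.inter_subset_left (by simp)
    _ = t' - t := Real.volume_real_Ico_of_le h

theorem work_eq_zero (σ : Schedule N) (τ : ℕ × ℕ) {t : ℝ}
    (h : ∀ s, 0 ≤ s → s < t → ¬ σ.Runs τ s) : σ.work τ t = 0 := by
  have hempty : {s | 0 ≤ s ∧ s < t ∧ σ.Runs τ s} = ∅ :=
    Set.eq_empty_of_forall_notMem fun s ⟨hs, hst, hrun⟩ => h s hs hst hrun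
  simp [work, hempty]

theorem work_mono (σ : Schedule N) (τ : ℕ × ℕ) : Monotone (σ.work τ) := by
  intro t t' h
  rw [work_eq_measureReal_Ico_inter, work_eq_measureReal_Ico_inter]
  exact measureReal_mono (Set.inter_subset_inter_left _ (Set.Ico_subset_Ico_right h))
    (measure_inter_ne_top_of_left_ne_top (by simp))

theorem work_congr {σ σ' : Schedule N} (τ : ℕ × ℕ) {t : ℝ}
    (h : ∀ m, ∀ s < t, σ m s = σ' m s) : σ.work τ t = σ'.work τ t := by
  have hset : {s | 0 ≤ s ∧ s < t ∧ σ.Runs τ s} = {s | 0 ≤ s ∧ s < t ∧ σ'.Runs τ s} := by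
    ext s
    refine and_congr_right fun _ => and_congr_right fun hs => ?_
    simp only [Runs, h _ s hs]
  rw [work, work, hset]

theorem sum_work_sub_work_le (σ : Schedule N)
    (hσ : ∀ m τ, MeasurableSet {t | σ m t = some τ}) (S : Finset (ℕ × ℕ)) {t t' : ℝ}
    (ht : 0 ≤ t) (h : t ≤ t') :
    ∑ τ ∈ S, (σ.work τ t' - σ.work τ t) ≤ N * (t' - t) := by
  have hmachine (m : Fin N) :
      ∑ τ ∈ S, volume.real (Set.Ico t t' ∩ {s | σ m s = some τ}) ≤ t' - t := by
    rw [← measureReal_biUnion_finset _ (fun τ _ => measurableSet_Ico.inter (hσ m τ))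
      fun τ _ => measure_inter_ne_top_of_left_ne_top (by simp)]
    · rw [← Real.volume_real_Ico_of_le h]
      exact measureReal_mono (by simp) (by simp)
    · intro τ _ τ' _ hne
      refine Set.disjoint_left.2 fun s ⟨_, hs⟩ ⟨_, hs'⟩ => hne ?_
      exact Option.some.inj (hs.symm.trans hs')
  calc ∑ τ ∈ S, (σ.work τ t' - σ.work τ t)
      ≤ ∑ τ ∈ S, ∑ m, volume.real (Set.Ico t t' ∩ {s | σ m s = some τ}) := by
        refine Finset.sum_le_sum fun τ _ => ?_
        rw [work_sub_work σ τ ht h, setOf_runs, Set.inter_iUnion]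
        exact measureReal_iUnion_fintype_le _
    _ = ∑ m, ∑ τ ∈ S, volume.real (Set.Ico t t' ∩ {s | σ m s = some τ}) := Finset.sum_comm
    _ ≤ ∑ _m : Fin N, (t' - t) := Finset.sum_le_sum fun m _ => hmachine m
    _ = N * (t' - t) := by rw [Finset.sum_const, Finset.card_fin, nsmul_eq_mul]

end Schedule

/-- The processing time of the first task of a job. In the instances of the adversary this is
(apart from one job) the only task, so that lower bounds can be read off the first tasks alone. -/
def Job.headSize (J : Job) : ℝ := (J.tasks.head J.tasks_ne_nil).size

theorem Job.headSize_pos (J : Job) : 0 < J.headSize := Task.size_pos _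

theorem Job.length_tasks_pos (J : Job) : 0 < J.tasks.length :=
  List.length_pos_iff.2 J.tasks_ne_nil

theorem Instance.hasTask_head (ω : Instance) (i : Fin ω.jobs.length) :
    ω.HasTask (i, 0) ω.jobs[i] (ω.jobs[i].tasks.head ω.jobs[i].tasks_ne_nil) :=
  ⟨by simp, by rw [← List.head?_eq_getElem?, List.head?_eq_some_head]⟩

namespace Feasible

variable {ω : Instance} {σ : Schedule N}

theorem work_le_size (hσ : Feasible ω σ) {τ : ℕ × ℕ} {J : Job} {T : Task}
    (h : ω.HasTask τ J T) (t : ℝ) : σ.work τ t ≤ T.size := by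
  obtain ⟨s, hs⟩ := hσ.complete τ J T h
  rcases le_total t s with hts | hst
  · exact hs ▸ σ.work_mono τ hts
  have hs0 : 0 ≤ s := by
    by_contra! hneg
    have hzero : σ.work τ s = 0 := σ.work_eq_zero τ fun u hu hus => by linarith
    linarith [T.size_pos]
  have hidle : Set.Ico s t ∩ {u | σ.Runs τ u} = ∅ := by
    refine Set.eq_empty_of_forall_notMem fun u ⟨hu, m, hm⟩ => ?_
    exact (hσ.unfinished m τ u J T h hm).not_ge (hs ▸ σ.work_mono τ hu.1)
  have hdiff := σ.work_sub_work τ hs0 hst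
  rw [hidle, measureReal_empty] at hdiff
  linarith

theorem work_eq_zero_of_le_release (hσ : Feasible ω σ) {τ : ℕ × ℕ} {J : Job}
    (hJ : ω.jobs[τ.1]? = some J) {t : ℝ} (ht : t ≤ J.release) : σ.work τ t = 0 := by
  refine σ.work_eq_zero τ fun s _ hs ⟨m, hm⟩ => ?_
  obtain ⟨J', T, ⟨hJ', _⟩, hrel⟩ := hσ.released m τ s hm
  obtain rfl : J = J' := Option.some.inj (hJ.symm.trans hJ')
  linarith

theorem work_head_le (hσ : Feasible ω σ) (i : Fin ω.jobs.length) (t : ℝ) :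
    σ.work (i, 0) t ≤ ω.jobs[i].headSize :=
  hσ.work_le_size (ω.hasTask_head i) t

theorem work_head_eq_zero (hσ : Feasible ω σ) (i : Fin ω.jobs.length) {t : ℝ}
    (ht : t ≤ ω.jobs[i].release) : σ.work (i, 0) t = 0 :=
  hσ.work_eq_zero_of_le_release (ω.hasTask_head i).1 ht

theorem le_jobCompletion_of_work_lt (hσ : Feasible ω σ) (i : Fin ω.jobs.length) {t : ℝ}
    (h : σ.work (i, 0) t < ω.jobs[i].headSize) : t ≤ jobCompletion ω σ i := by
  let first : Fin ω.jobs[i].tasks.length := ⟨0, ω.jobs[i].length_tasks_pos⟩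
  have hsize : ω.jobs[i].tasks[first].size = ω.jobs[i].headSize :=
    congrArg Task.size (List.head_eq_getElem _).symm
  calc t ≤ taskCompletion ω σ i first := by
        refine le_csInf ?_ fun s hs => ?_
        · obtain ⟨s, hs⟩ := hσ.complete _ _ _ (ω.hasTask_head i)
          exact ⟨s, hs.trans hsize.symm⟩
        · by_contra! hst
          exact h.not_ge (hsize ▸ hs ▸ σ.work_mono _ hst.le)
    _ ≤ jobCompletion ω σ i :=
        le_ciSup (f := taskCompletion ω σ i) (Set.finite_range _).bddAbove first

theorem release_add_headSize_le (hσ : Feasible ω σ) (i : Fin ω.jobs.length) :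
    ω.jobs[i].release + ω.jobs[i].headSize ≤ jobCompletion ω σ i := by
  refine le_of_forall_lt_imp_le_of_dense fun t ht => hσ.le_jobCompletion_of_work_lt i ?_
  rcases le_total t ω.jobs[i].release with hle | hge
  · rw [hσ.work_head_eq_zero i hle]
    exact Job.headSize_pos _
  · have hzero := hσ.work_head_eq_zero i le_rfl
    have hrate := σ.work_sub_work_le (i, 0) ω.jobs[i].release_nonneg hge
    linarith

theorem sum_headSize_le (hσ : Feasible ω σ) :
    ∑ i : Fin ω.jobs.length, ω.jobs[i].headSize ≤ totalResponse ω σ :=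
  Finset.sum_le_sum fun i _ => by linarith [hσ.release_add_headSize_le i]

theorem optCost_le (hσ : Feasible ω σ) : optCost N ω ≤ totalResponse ω σ := by
  refine csInf_le ⟨∑ i : Fin ω.jobs.length, ω.jobs[i].headSize, ?_⟩ ⟨σ, hσ, rfl⟩
  rintro _ ⟨σ', hσ', rfl⟩
  exact hσ'.sum_headSize_le

theorem optCost_pos (hσ : Feasible ω σ) : 0 < optCost N ω := by
  have : Nonempty (Fin ω.jobs.length) := ⟨⟨0, List.length_pos_iff.2 ω.jobs_ne_nil⟩⟩
  calc 0 < ∑ i : Fin ω.jobs.length, ω.jobs[i].headSize :=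
        Finset.sum_pos (fun i _ => Job.headSize_pos _) Finset.univ_nonempty
    _ ≤ optCost N ω := by
        refine le_csInf ⟨_, σ, hσ, rfl⟩ ?_
        rintro _ ⟨σ', hσ', rfl⟩
        exact hσ'.sum_headSize_le

end Feasible

/-! ### Backlog and pending jobs -/

open Classical in
/-- The jobs released before time `t` whose first task has its size in `C`. -/
def Instance.arrived (ω : Instance) (C : Set ℝ) (t : ℝ) : Finset (Fin ω.jobs.length) :=
  {i | ω.jobs[i].release < t ∧ ω.jobs[i].headSize ∈ C}

open Classical in
/-- The total size of the first tasks, with sizes in `C`, of the jobs of `l` that are released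
in `[t, t')`. -/
def arrivals (l : List Job) (C : Set ℝ) (t t' : ℝ) : ℝ :=
  (l.map fun J => if J.release ∈ Set.Ico t t' ∧ J.headSize ∈ C then J.headSize else 0).sum

/-- The backlog of the size class `C`: the unprocessed amount at time `t` of the first tasks with
sizes in `C` of the jobs released before `t`. -/
def backlog (ω : Instance) (σ : Schedule N) (C : Set ℝ) (t : ℝ) : ℝ :=
  ∑ i ∈ ω.arrived C t, (ω.jobs[i].headSize - σ.work (i, 0) t)

open Classical in
/-- The jobs released before `t` whose first task is unfinished at time `t`. -/
def pending (ω : Instance) (σ : Schedule N) (t : ℝ) : Finset (Fin ω.jobs.length) :=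
  {i : Fin ω.jobs.length | ω.jobs[i].release < t ∧ σ.work (i, 0) t < ω.jobs[i].headSize}

section

variable {ω : Instance} {C : Set ℝ} {t t' : ℝ}

theorem Instance.mem_arrived {i : Fin ω.jobs.length} :
    i ∈ ω.arrived C t ↔ ω.jobs[i].release < t ∧ ω.jobs[i].headSize ∈ C := by
  simp [arrived]

theorem Instance.arrived_mono (ω : Instance) {D : Set ℝ} (hCD : C ⊆ D) (h : t ≤ t') :
    ω.arrived C t ⊆ ω.arrived D t' := fun i hi => by
  rw [mem_arrived] at hi ⊢
  exact ⟨hi.1.trans_le h, hCD hi.2⟩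

open Classical in
theorem Instance.card_arrived (ω : Instance) (C : Set ℝ) (t : ℝ) :
    #(ω.arrived C t) = ω.jobs.countP fun J => J.release < t ∧ J.headSize ∈ C := by
  have hcount (l : List Job) (p : Job → Prop) [DecidablePred p] :
      #{i : Fin l.length | p l[i]} = l.countP p := by
    conv_rhs => rw [← List.ofFn_getElem (xs := l), ← Multiset.coe_countP, ← Fin.univ_val_map,
      Multiset.countP_map]
    rfl
  exact hcount ω.jobs fun J => J.release < t ∧ J.headSize ∈ C

open Classical in
theorem Instance.arrivals_eq_sum (ω : Instance) :
    arrivals ω.jobs C t t' =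
      ∑ i ∈ ω.arrived C t' \ ω.arrived C t, ω.jobs[i].headSize := by
  rw [arrivals, ← Fin.sum_univ_fun_getElem, ← Finset.sum_filter]
  refine Finset.sum_congr (Finset.ext fun i => ?_) fun i _ => rfl
  simp only [Finset.mem_filter, Finset.mem_sdiff, mem_arrived]
  grind

theorem sum_headSize_le_arrivals {Y l : List Job} (hYl : Y <+ l)
    (hY : ∀ J ∈ Y, J.release ∈ Set.Ico t t' ∧ J.headSize ∈ C) :
    (Y.map Job.headSize).sum ≤ arrivals l C t t' := by
  classical
  calc (Y.map Job.headSize).sum = arrivals Y C t t' :=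
        congrArg List.sum (List.map_congr_left fun J hJ => (if_pos (hY J hJ)).symm)
    _ ≤ arrivals l C t t' := by
        refine (hYl.map _).sum_le_sum fun x hx => ?_
        obtain ⟨J, -, rfl⟩ := List.mem_map.1 hx
        split_ifs
        exacts [J.headSize_pos.le, le_rfl]

theorem backlog_union {σ : Schedule N} {D : Set ℝ} (h : Disjoint C D) :
    backlog ω σ (C ∪ D) t = backlog ω σ C t + backlog ω σ D t := by
  classical
  rw [backlog, backlog, backlog, ← Finset.sum_union]
  · refine Finset.sum_congr (Finset.ext fun i => ?_) fun i _ => rfl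
    simp only [Instance.mem_arrived, Finset.mem_union, Set.mem_union, and_or_left]
  · refine Finset.disjoint_left.2 fun i hC hD => ?_
    exact Set.disjoint_left.1 h (Instance.mem_arrived.1 hC).2 (Instance.mem_arrived.1 hD).2

end

namespace Feasible

variable {ω : Instance} {σ : Schedule N} {t t' : ℝ}

theorem residual_nonneg (hσ : Feasible ω σ) (i : Fin ω.jobs.length) (t : ℝ) :
    0 ≤ ω.jobs[i].headSize - σ.work (i, 0) t :=
  sub_nonneg.2 (hσ.work_head_le i t)

theorem backlog_nonneg (hσ : Feasible ω σ) (C : Set ℝ) (t : ℝ) : 0 ≤ backlog ω σ C t :=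
  Finset.sum_nonneg fun i _ => hσ.residual_nonneg i t

theorem backlog_mono (hσ : Feasible ω σ) {C D : Set ℝ} (h : C ⊆ D) (t : ℝ) :
    backlog ω σ C t ≤ backlog ω σ D t :=
  Finset.sum_le_sum_of_subset_of_nonneg (ω.arrived_mono h le_rfl)
    fun i _ _ => hσ.residual_nonneg i t

theorem backlog_add_arrivals_le (hσ : Feasible ω σ) (C : Set ℝ) (ht : 0 ≤ t) (h : t ≤ t') :
    backlog ω σ C t + arrivals ω.jobs C t t' ≤ backlog ω σ C t' + N * (t' - t) := by
  classical
  let heads : Finset (ℕ × ℕ) := (ω.arrived C t').map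
    ⟨fun i => (i.val, 0), fun i j hij => Fin.ext (Prod.ext_iff.1 hij).1⟩
  have hwork : ∑ i ∈ ω.arrived C t', (σ.work (i, 0) t' - σ.work (i, 0) t) ≤ N * (t' - t) := by
    have hheads := σ.sum_work_sub_work_le hσ.measurable heads ht h
    rwa [Finset.sum_map] at hheads
  have hnew : ∑ i ∈ ω.arrived C t' \ ω.arrived C t, (ω.jobs[i].headSize - σ.work (i, 0) t) =
      ∑ i ∈ ω.arrived C t' \ ω.arrived C t, ω.jobs[i].headSize := by
    refine Finset.sum_congr rfl fun i hi => ?_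
    have hrel : t ≤ ω.jobs[i].release := by
      simp only [Finset.mem_sdiff, Instance.mem_arrived] at hi
      by_contra! hlt
      exact hi.2 ⟨hlt, hi.1.2⟩
    rw [hσ.work_head_eq_zero i hrel, sub_zero]
  rw [ω.arrivals_eq_sum, ← hnew, backlog, backlog, add_comm,
    Finset.sum_sdiff (ω.arrived_mono subset_rfl h)]
  rw [Finset.sum_sub_distrib] at hwork ⊢
  rw [Finset.sum_sub_distrib]
  linarith

theorem backlog_sub_card_mul_le (hσ : Feasible ω σ) (C : Set ℝ) (ht : 0 ≤ t) (h : t ≤ t') :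
    backlog ω σ C t - #(ω.arrived C t) * (t' - t) ≤ backlog ω σ C t' := by
  calc backlog ω σ C t - #(ω.arrived C t) * (t' - t)
      = ∑ i ∈ ω.arrived C t, (ω.jobs[i].headSize - σ.work (i, 0) t - (t' - t)) := by
        rw [Finset.sum_sub_distrib, Finset.sum_const, nsmul_eq_mul, backlog]
    _ ≤ ∑ i ∈ ω.arrived C t, (ω.jobs[i].headSize - σ.work (i, 0) t') :=
        Finset.sum_le_sum fun i _ => by linarith [σ.work_sub_work_le (i, 0) ht h]
    _ ≤ backlog ω σ C t' :=
        Finset.sum_le_sum_of_subset_of_nonneg (ω.arrived_mono subset_rfl h)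
          fun i _ _ => hσ.residual_nonneg i t'

open Classical in
theorem backlog_eq_sum_pending (hσ : Feasible ω σ) (C : Set ℝ) (t : ℝ) :
    backlog ω σ C t =
      ∑ i ∈ pending ω σ t with ω.jobs[i].headSize ∈ C,
        (ω.jobs[i].headSize - σ.work (i, 0) t) := by
  refine (Finset.sum_subset (fun i hi => ?_) fun i hi hi' => ?_).symm
  · rw [Finset.mem_filter, pending, Finset.mem_filter_univ] at hi
    exact Instance.mem_arrived.2 ⟨hi.1.1, hi.2⟩
  · rw [Instance.mem_arrived] at hi
    rw [Finset.mem_filter, pending, Finset.mem_filter_univ] at hi'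
    by_contra hne
    exact hi' ⟨⟨hi.1, sub_pos.1 ((hσ.residual_nonneg i t).lt_of_ne' hne)⟩, hi.2⟩

theorem backlog_Iic_le (hσ : Feasible ω σ) {θ : ℝ} (hθ : 0 ≤ θ) (t : ℝ) :
    backlog ω σ (Set.Iic θ) t ≤ #(pending ω σ t) * θ := by
  classical
  rw [hσ.backlog_eq_sum_pending, Finset.sum_filter, ← nsmul_eq_mul, ← Finset.sum_const]
  refine Finset.sum_le_sum fun i _ => ?_
  split_ifs with hi
  · linarith [σ.work_nonneg (i, 0) t, Set.mem_Iic.1 hi]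
  · exact hθ

theorem sum_backlog_Iic_div_le (hσ : Feasible ω σ) {k : ℕ} {θ : ℕ → ℝ} {K : ℝ}
    (hK : ∀ s : ℝ, 0 < s → ∑ j ∈ Finset.range k with s ≤ θ j, (θ j)⁻¹ ≤ K / s)
    (t : ℝ) :
    ∑ j ∈ Finset.range k, backlog ω σ (Set.Iic (θ j)) t / θ j ≤ #(pending ω σ t) * K := by
  classical
  have hjob (i : Fin ω.jobs.length) : ∑ j ∈ Finset.range k with ω.jobs[i].headSize ≤ θ j,
      (ω.jobs[i].headSize - σ.work (i, 0) t) / θ j ≤ K := by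
    have hpos := ω.jobs[i].headSize_pos
    simp only [div_eq_mul_inv, ← Finset.mul_sum]
    calc (ω.jobs[i].headSize - σ.work (i, 0) t) *
          ∑ j ∈ Finset.range k with ω.jobs[i].headSize ≤ θ j, (θ j)⁻¹
        ≤ ω.jobs[i].headSize * (K / ω.jobs[i].headSize) :=
          mul_le_mul (by linarith [σ.work_nonneg (i, 0) t]) (hK _ hpos)
            (Finset.sum_nonneg fun j hj =>
              inv_nonneg.2 (hpos.le.trans (Finset.mem_filter.1 hj).2)) hpos.le
      _ = K := mul_div_cancel₀ K hpos.ne'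
  calc ∑ j ∈ Finset.range k, backlog ω σ (Set.Iic (θ j)) t / θ j
      = ∑ j ∈ Finset.range k, ∑ i ∈ pending ω σ t with ω.jobs[i].headSize ≤ θ j,
          (ω.jobs[i].headSize - σ.work (i, 0) t) / θ j := by
        simp only [hσ.backlog_eq_sum_pending, Finset.sum_div, Set.mem_Iic]
    _ = ∑ i ∈ pending ω σ t, ∑ j ∈ Finset.range k with ω.jobs[i].headSize ≤ θ j,
          (ω.jobs[i].headSize - σ.work (i, 0) t) / θ j := by
        simp only [Finset.sum_filter]
        exact Finset.sum_comm
    _ ≤ ∑ _i ∈ pending ω σ t, K := Finset.sum_le_sum fun i _ => hjob i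
    _ = #(pending ω σ t) * K := by rw [Finset.sum_const, nsmul_eq_mul]

/-- Release dates are integral so that a job released at `r` and completed at `c` is pending at
no more than `c - r` integral times. -/
theorem sum_card_pending_le (hσ : Feasible ω σ)
    (hr : ∀ J ∈ ω.jobs, ∃ n : ℕ, J.release = n) (a b : ℕ) :
    ∑ t ∈ Finset.Ioc a b, (#(pending ω σ t) : ℝ) ≤ totalResponse ω σ := by
  classical
  have hjob (i : Fin ω.jobs.length) :
      (#{t ∈ Finset.Ioc a b | i ∈ pending ω σ (t : ℕ)} : ℝ) ≤
        jobCompletion ω σ i - ω.jobs[i].release := by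
    obtain ⟨r, hr⟩ := hr ω.jobs[i] (List.getElem_mem _)
    have hC := hσ.release_add_headSize_le i
    rw [hr] at hC ⊢
    have hrC : (r : ℝ) ≤ jobCompletion ω σ i := by linarith [ω.jobs[i].headSize_pos]
    have hsub : {t ∈ Finset.Ioc a b | i ∈ pending ω σ (t : ℕ)} ⊆
        Finset.Ioc r ⌊jobCompletion ω σ i⌋₊ := fun t ht => by
      rw [Finset.mem_filter, pending, Finset.mem_filter_univ, hr] at ht
      exact Finset.mem_Ioc.2
        ⟨by exact_mod_cast ht.2.1, Nat.le_floor (hσ.le_jobCompletion_of_work_lt i ht.2.2)⟩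
    have hcard := Finset.card_le_card hsub
    rw [Nat.card_Ioc] at hcard
    calc (#{t ∈ Finset.Ioc a b | i ∈ pending ω σ (t : ℕ)} : ℝ)
        ≤ (⌊jobCompletion ω σ i⌋₊ - r : ℕ) := by exact_mod_cast hcard
      _ = ⌊jobCompletion ω σ i⌋₊ - r := Nat.cast_sub (Nat.le_floor hrC)
      _ ≤ jobCompletion ω σ i - r :=
          sub_le_sub_right (Nat.floor_le ((Nat.cast_nonneg r).trans hrC)) _
  calc ∑ t ∈ Finset.Ioc a b, (#(pending ω σ t) : ℝ)
      = ∑ i : Fin ω.jobs.length, (#{t ∈ Finset.Ioc a b | i ∈ pending ω σ (t : ℕ)} : ℝ) := by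
        have hswap := Finset.sum_card_bipartiteAbove_eq_sum_card_bipartiteBelow
          (s := Finset.Ioc a b) (t := Finset.univ) fun (t : ℕ) i => i ∈ pending ω σ t
        simp only [Finset.bipartiteAbove, Finset.bipartiteBelow, Finset.filter_univ_mem] at hswap
        exact_mod_cast hswap
    _ ≤ totalResponse ω σ := Finset.sum_le_sum fun i _ => hjob i

end Feasible

/-- The instance `ω` starts with the jobs of `X`, all others being released at time `t` or later:
before `t`, an online algorithm cannot tell apart the instances continuing `X` from time `t`. -/
def Instance.Continues (ω : Instance) (X : List Job) (t : ℝ) : Prop :=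
  ∃ Y, ω.jobs = X ++ Y ∧ ∀ J ∈ Y, t ≤ J.release

namespace Instance.Continues

variable {ω ω' : Instance} {X Y : List Job} {s t : ℝ}

theorem sublist (h : ω.Continues X t) : X <+ ω.jobs := by
  obtain ⟨Y, hω, -⟩ := h
  exact hω ▸ List.sublist_append_left X Y

theorem mono (h : ω.Continues X t) (hst : s ≤ t) : ω.Continues X s := by
  obtain ⟨Y, hω, hY⟩ := h
  exact ⟨Y, hω, fun J hJ => hst.trans (hY J hJ)⟩

theorem of_append (h : ω.Continues (X ++ Y) t) (hY : ∀ J ∈ Y, s ≤ J.release) (hst : s ≤ t) :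
    ω.Continues X s := by
  obtain ⟨Z, hω, hZ⟩ := h
  refine ⟨Y ++ Z, hω.trans (List.append_assoc X Y Z), fun J hJ => ?_⟩
  exact (List.mem_append.1 hJ).elim (hY J) fun hJZ => hst.trans (hZ J hJZ)

theorem agreeUpTo (h : ω.Continues X t) (h' : ω'.Continues X t) (hst : s < t) :
    AgreeUpTo ω ω' s := by
  obtain ⟨Y, hω, hY⟩ := h
  obtain ⟨Y', hω', hY'⟩ := h'
  have hlate {Z : List Job} (hZ : ∀ J ∈ Z, t ≤ J.release) {J : Job} (hJ : J.release ≤ s)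
      (n : ℕ) : Z[n]? ≠ some J := fun hn =>
    (hJ.trans_lt hst).not_ge (hZ J (List.mem_of_getElem? hn))
  intro i J hJ
  rw [hω, hω', List.getElem?_append, List.getElem?_append]
  split_ifs
  · rfl
  · exact iff_of_false (hlate hY hJ _) (hlate hY' hJ _)

open Classical in
theorem backlog_eq_sum (h : ω.Continues X t) (σ : Schedule N) (C : Set ℝ) :
    backlog ω σ C t = ∑ i : Fin X.length with X[i].release < t ∧ X[i].headSize ∈ C,
      (X[i].headSize - σ.work (i, 0) t) := by
  obtain ⟨Y, hω, hY⟩ := h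
  obtain ⟨jobs, _, _⟩ := ω
  obtain rfl : jobs = X ++ Y := hω
  have hnew (i : Fin Y.length) : ¬ Y[i].release < t := (hY _ (List.getElem_mem _)).not_gt
  simp only [backlog, Instance.arrived, Finset.sum_filter]
  rw [← (finCongr (List.length_append (as := X) (bs := Y))).symm.sum_comp, Fin.sum_univ_add,
    Finset.sum_eq_zero (s := (Finset.univ : Finset (Fin Y.length))), add_zero]
  · simp
  · intro i _
    simpa using fun hlt _ => absurd hlt (hnew i)

theorem backlog_eq (h : ω.Continues X t) (h' : ω'.Continues X t) (A : OnlineAlgorithm N)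
    (C : Set ℝ) :
    backlog ω (A.schedule ω) C t = backlog ω' (A.schedule ω') C t := by
  classical
  have hwork (τ : ℕ × ℕ) : (A.schedule ω).work τ t = (A.schedule ω').work τ t :=
    Schedule.work_congr τ fun m s hs => A.causal ω ω' s (h.agreeUpTo h' hs) m s le_rfl
  simp only [h.backlog_eq_sum, h'.backlog_eq_sum, hwork]

end Instance.Continues

/-! ### Offline plans -/

/-- One line of an offline plan: the tasks of `job` are processed one after the other, without
interruption, on one machine (the machines are numbered from `0`) from the time `start` on. -/
structure Entry where
  job : Job
  machine : ℕ
  start : ℝ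

namespace Entry

/-- The time at which an entry of a plan releases its machine. -/
def finish (e : Entry) : ℝ := e.start + e.job.workload

/-- The time at which task number `ℓ` is started. -/
def taskStart (e : Entry) (ℓ : ℕ) : ℝ := e.start + ((e.job.tasks.take ℓ).map Task.size).sum

/-- The time during which task number `ℓ` is processed (empty if there is no such task). -/
def slot (e : Entry) (ℓ : ℕ) : Set ℝ := Set.Ico (e.taskStart ℓ) (e.taskStart (ℓ + 1))

/-- Two entries do not occupy a machine at the same time. -/
def Compatible (e e' : Entry) : Prop :=
  e.machine ≠ e'.machine ∨ e.finish ≤ e'.start ∨ e'.finish ≤ e.start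

theorem Compatible.symm {e e' : Entry} (h : e.Compatible e') : e'.Compatible e :=
  h.imp Ne.symm Or.symm

theorem taskStart_succ {e : Entry} {ℓ : ℕ} {T : Task} (h : e.job.tasks[ℓ]? = some T) :
    e.taskStart (ℓ + 1) = e.taskStart ℓ + T.size := by
  simp [taskStart, List.take_add_one, h, add_assoc]

theorem monotone_taskStart (e : Entry) : Monotone e.taskStart := by
  refine monotone_nat_of_le_succ fun ℓ => ?_
  rcases h : e.job.tasks[ℓ]? with _ | T
  · simp [taskStart, List.take_add_one, h]
  · linarith [taskStart_succ h, T.size_pos]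

theorem start_le_taskStart (e : Entry) (ℓ : ℕ) : e.start ≤ e.taskStart ℓ := by
  simpa [taskStart] using e.monotone_taskStart ℓ.zero_le

theorem taskStart_le_finish (e : Entry) (ℓ : ℕ) : e.taskStart ℓ ≤ e.finish := by
  calc e.taskStart ℓ ≤ e.taskStart (max ℓ e.job.tasks.length) :=
        e.monotone_taskStart (le_max_left _ _)
    _ = e.finish := by
        rw [taskStart, List.take_of_length_le (le_max_right _ _), finish, Job.workload]

theorem exists_task_of_mem_slot {e : Entry} {ℓ : ℕ} {t : ℝ} (h : t ∈ e.slot ℓ) :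
    ∃ T, e.job.tasks[ℓ]? = some T := by
  refine Option.ne_none_iff_exists'.1 fun hnone => ?_
  have hempty : e.taskStart (ℓ + 1) = e.taskStart ℓ := by
    simp [taskStart, List.take_add_one, hnone]
  exact (h.1.trans_lt h.2).ne' hempty

end Entry

/-- The plan `l` can be executed on `N` machines during the time window `[a, b)`. -/
structure Fits (N : ℕ) (a b : ℝ) (l : List Entry) : Prop where
  le_start : ∀ e ∈ l, a ≤ e.start
  release_le : ∀ e ∈ l, e.job.release ≤ e.start
  finish_le : ∀ e ∈ l, e.finish ≤ b
  machine_lt : ∀ e ∈ l, e.machine < N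
  pairwise_compatible : l.Pairwise Entry.Compatible

namespace Fits

variable {a b c : ℝ} {l l' : List Entry}

theorem nil : Fits N a b [] := by
  constructor <;> simp

theorem mono {a' b' : ℝ} (h : Fits N a b l) (ha : a' ≤ a) (hb : b ≤ b') : Fits N a' b' l where
  le_start e he := ha.trans (h.le_start e he)
  release_le := h.release_le
  finish_le e he := (h.finish_le e he).trans hb
  machine_lt := h.machine_lt
  pairwise_compatible := h.pairwise_compatible

theorem perm (h : Fits N a b l) (hl : l ~ l') : Fits N a b l' where
  le_start e he := h.le_start e (hl.mem_iff.2 he)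
  release_le e he := h.release_le e (hl.mem_iff.2 he)
  finish_le e he := h.finish_le e (hl.mem_iff.2 he)
  machine_lt e he := h.machine_lt e (hl.mem_iff.2 he)
  pairwise_compatible := (hl.pairwise_iff Entry.Compatible.symm).1 h.pairwise_compatible

theorem append_of_compatible (h : Fits N a b l) (h' : Fits N a b l')
    (hc : ∀ e ∈ l, ∀ e' ∈ l', e.Compatible e') : Fits N a b (l ++ l') where
  le_start := List.forall_mem_append.2 ⟨h.le_start, h'.le_start⟩
  release_le := List.forall_mem_append.2 ⟨h.release_le, h'.release_le⟩
  finish_le := List.forall_mem_append.2 ⟨h.finish_le, h'.finish_le⟩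
  machine_lt := List.forall_mem_append.2 ⟨h.machine_lt, h'.machine_lt⟩
  pairwise_compatible :=
    List.pairwise_append.2 ⟨h.pairwise_compatible, h'.pairwise_compatible, hc⟩

theorem append (h : Fits N a b l) (h' : Fits N b c l') (hab : a ≤ b) (hbc : b ≤ c) :
    Fits N a c (l ++ l') :=
  (h.mono le_rfl hbc).append_of_compatible (h'.mono hab le_rfl) fun e he e' he' =>
    Or.inr (Or.inl ((h.finish_le e he).trans (h'.le_start e' he')))

theorem flatMap_range {s : ℕ → ℝ} (hs : Monotone s) {f : ℕ → List Entry} {k : ℕ}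
    (h : ∀ j < k, Fits N (s j) (s (j + 1)) (f j)) :
    Fits N (s 0) (s k) ((List.range k).flatMap f) := by
  induction k with
  | zero => exact nil
  | succ k ih =>
    rw [List.range_succ, List.flatMap_append, List.flatMap_singleton]
    exact (ih fun j hj => h j (hj.trans k.lt_succ_self)).append (h k k.lt_succ_self)
      (hs k.zero_le) (hs k.le_succ)

end Fits

/-- The plan `l` processes task number `τ.2` of its entry number `τ.1` on machine `m` at time
`t`. -/
def PlanRuns (l : List Entry) (τ : ℕ × ℕ) (m : ℕ) (t : ℝ) : Prop :=
  ∃ e, l[τ.1]? = some e ∧ e.machine = m ∧ t ∈ e.slot τ.2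

theorem Fits.planRuns_unique {a b : ℝ} {l : List Entry} (hl : Fits N a b l) {τ τ' : ℕ × ℕ}
    {m : ℕ} {t : ℝ} (h : PlanRuns l τ m t) (h' : PlanRuns l τ' m t) : τ = τ' := by
  obtain ⟨e, he, hm, ht⟩ := h
  obtain ⟨e', he', hm', ht'⟩ := h'
  have hnot : ¬ e.Compatible e' := by
    rintro (hne | hle | hle)
    · exact hne (hm.trans hm'.symm)
    · linarith [ht.2, e.taskStart_le_finish (τ.2 + 1), e'.start_le_taskStart τ'.2, ht'.1]
    · linarith [ht'.2, e'.taskStart_le_finish (τ'.2 + 1), e.start_le_taskStart τ.2, ht.1]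
  have hjob : τ.1 = τ'.1 := by
    obtain ⟨hi, rfl⟩ := List.getElem?_eq_some_iff.1 he
    obtain ⟨hi', rfl⟩ := List.getElem?_eq_some_iff.1 he'
    have hpair := List.pairwise_iff_getElem.1 hl.pairwise_compatible
    by_contra hne
    rcases lt_or_gt_of_ne hne with hlt | hgt
    · exact hnot (hpair _ _ hi hi' hlt)
    · exact hnot (hpair _ _ hi' hi hgt).symm
  obtain rfl : e = e' := Option.some.inj (he.symm.trans (hjob ▸ he'))
  refine Prod.ext hjob (by_contra fun hne => ?_)
  exact Set.disjoint_left.1 (e.monotone_taskStart.pairwise_disjoint_on_Ico_succ hne) ht ht'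

open Classical in
/-- The schedule that executes a plan; it is meaningful for plans that fit, which never run two
tasks at a time on one machine. -/
def planSchedule (N : ℕ) (l : List Entry) : Schedule N := fun m t =>
  if h : ∃ τ, PlanRuns l τ m t then some h.choose else none

/-- The sum of the response times of the jobs of a plan. -/
def planCost (l : List Entry) : ℝ := (l.map fun e => e.finish - e.job.release).sum

theorem planCost_append (l l' : List Entry) : planCost (l ++ l') = planCost l + planCost l' := by
  simp [planCost]

theorem planCost_le_length_mul {l : List Entry} {K : ℝ}
    (h : ∀ e ∈ l, e.finish - e.job.release ≤ K) : planCost l ≤ l.length * K := by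
  rw [← nsmul_eq_mul, ← List.length_map (as := l) fun e => e.finish - e.job.release]
  exact List.sum_le_card_nsmul _ K (by simpa using h)

theorem Fits.planCost_le {a b r : ℝ} {l : List Entry} (hl : Fits N a b l)
    (hr : ∀ J ∈ l.map Entry.job, r ≤ J.release) : planCost l ≤ l.length * (b - r) :=
  planCost_le_length_mul fun e he =>
    sub_le_sub (hl.finish_le e he) (hr _ (List.mem_map_of_mem he))

theorem Instance.HasTask.exists_entry {ω : Instance} {τ : ℕ × ℕ} {J : Job} {T : Task}
    (h : ω.HasTask τ J T) {l : List Entry} (hω : ω.jobs = l.map Entry.job) :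
    ∃ e, l[τ.1]? = some e ∧ e.job = J ∧ e.job.tasks[τ.2]? = some T := by
  obtain ⟨hJ, hT⟩ := h
  rw [hω, List.getElem?_map, Option.map_eq_some_iff] at hJ
  obtain ⟨e, he, rfl⟩ := hJ
  exact ⟨e, he, rfl, hT⟩

namespace Fits

variable {a b : ℝ} {l : List Entry} {ω : Instance}

theorem planSchedule_eq_some_iff (hl : Fits N a b l) {m : Fin N} {t : ℝ} {τ : ℕ × ℕ} :
    planSchedule N l m t = some τ ↔ PlanRuns l τ m t := by
  unfold planSchedule
  split_ifs with h
  · rw [Option.some_inj]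
    exact ⟨fun hτ => hτ ▸ h.choose_spec, hl.planRuns_unique h.choose_spec⟩
  · exact iff_of_false (by simp) fun hτ => h ⟨τ, hτ⟩

theorem planSchedule_eq_some_iff_of_entry (hl : Fits N a b l) {m : Fin N} {t : ℝ} {τ : ℕ × ℕ}
    {e : Entry} (he : l[τ.1]? = some e) :
    planSchedule N l m t = some τ ↔ e.machine = m ∧ t ∈ e.slot τ.2 := by
  simp [hl.planSchedule_eq_some_iff, PlanRuns, he]

theorem planSchedule_runs_iff (hl : Fits N a b l) {t : ℝ} {τ : ℕ × ℕ} {e : Entry}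
    (he : l[τ.1]? = some e) : (planSchedule N l).Runs τ t ↔ t ∈ e.slot τ.2 := by
  have hm : e.machine < N := hl.machine_lt e (List.mem_of_getElem? he)
  simp only [Schedule.Runs, hl.planSchedule_eq_some_iff_of_entry he, exists_and_right,
    and_iff_right_iff_imp]
  exact fun _ => ⟨⟨e.machine, hm⟩, rfl⟩

theorem planSchedule_work (hl : Fits N a b l) {τ : ℕ × ℕ} {e : Entry} (he : l[τ.1]? = some e)
    {t : ℝ} (ht : t ∈ Set.Icc (e.taskStart τ.2) (e.taskStart (τ.2 + 1))) :
    (planSchedule N l).work τ t = t - e.taskStart τ.2 := by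
  have hset : {s | 0 ≤ s ∧ s < t ∧ (planSchedule N l).Runs τ s} =
      Set.Ico (e.taskStart τ.2) t := by
    have hrel := hl.release_le e (List.mem_of_getElem? he)
    have h0 : 0 ≤ e.taskStart τ.2 :=
      (e.job.release_nonneg.trans hrel).trans (e.start_le_taskStart _)
    ext s
    rw [Set.mem_ofPred_eq, hl.planSchedule_runs_iff he]
    exact ⟨fun ⟨_, hst, hs⟩ => ⟨hs.1, hst⟩,
      fun hs => ⟨h0.trans hs.1, hs.2, hs.1, hs.2.trans_le ht.2⟩⟩
  rw [Schedule.work, hset, Real.volume_real_Ico_of_le ht.1]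

theorem planSchedule_work_eq_size (hl : Fits N a b l) {τ : ℕ × ℕ} {e : Entry}
    (he : l[τ.1]? = some e) {T : Task} (hT : e.job.tasks[τ.2]? = some T) :
    (planSchedule N l).work τ (e.taskStart (τ.2 + 1)) = T.size := by
  rw [hl.planSchedule_work he (Set.right_mem_Icc.2 (e.monotone_taskStart τ.2.le_succ)),
    Entry.taskStart_succ hT, add_sub_cancel_left]

theorem measurableSet_planSchedule (hl : Fits N a b l) (m : Fin N) (τ : ℕ × ℕ) :
    MeasurableSet {t | planSchedule N l m t = some τ} := by
  rcases he : l[τ.1]? with _ | e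
  · simp [hl.planSchedule_eq_some_iff, PlanRuns, he]
  · simp only [hl.planSchedule_eq_some_iff_of_entry he]
    exact (MeasurableSet.const _).inter measurableSet_Ico

theorem feasible_planSchedule (hl : Fits N a b l) (hω : ω.jobs = l.map Entry.job) :
    Feasible ω (planSchedule N l) where
  measurable := hl.measurableSet_planSchedule
  released m τ t h := by
    obtain ⟨e, he, -, ht⟩ := hl.planSchedule_eq_some_iff.1 h
    obtain ⟨T, hT⟩ := Entry.exists_task_of_mem_slot ht
    refine ⟨e.job, T, ⟨by rw [hω, List.getElem?_map, he, Option.map_some], hT⟩, ?_⟩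
    exact (hl.release_le e (List.mem_of_getElem? he)).trans ((e.start_le_taskStart _).trans ht.1)
  sequential m m' τ t h h' := by
    obtain ⟨e, he, hm, -⟩ := hl.planSchedule_eq_some_iff.1 h
    exact Fin.ext (hm.symm.trans ((hl.planSchedule_eq_some_iff_of_entry he).1 h').1)
  unfinished m τ t J T h hrun := by
    obtain ⟨e, he, rfl, hT⟩ := h.exists_entry hω
    have ht := ((hl.planSchedule_eq_some_iff_of_entry he).1 hrun).2
    rw [hl.planSchedule_work he ⟨ht.1, ht.2.le⟩, sub_lt_iff_lt_add', ← Entry.taskStart_succ hT]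
    exact ht.2
  complete τ J T h := by
    obtain ⟨e, he, rfl, hT⟩ := h.exists_entry hω
    exact ⟨_, hl.planSchedule_work_eq_size he hT⟩
  nonpreemptive τ J T h _ := by
    obtain ⟨e, he, rfl, hT⟩ := h.exists_entry hω
    refine ⟨⟨e.machine, hl.machine_lt e (List.mem_of_getElem? he)⟩, e.taskStart τ.2,
      fun m t => ?_⟩
    rw [hl.planSchedule_eq_some_iff_of_entry he, ← Entry.taskStart_succ hT, eq_comm,
      ← Fin.val_inj]
    rfl

theorem jobCompletion_planSchedule_le (hl : Fits N a b l) (hω : ω.jobs = l.map Entry.job)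
    {i : Fin ω.jobs.length} {e : Entry} (he : l[i.val]? = some e) :
    jobCompletion ω (planSchedule N l) i ≤ e.finish := by
  have : Nonempty (Fin ω.jobs[i].tasks.length) := ⟨⟨0, ω.jobs[i].length_tasks_pos⟩⟩
  refine ciSup_le fun ℓ => ?_
  have htask : ω.HasTask (i, ℓ) ω.jobs[i] ω.jobs[i].tasks[ℓ] := ⟨by simp, by simp⟩
  obtain ⟨e', he', -, hT⟩ := htask.exists_entry hω
  obtain rfl : e = e' := Option.some.inj (he.symm.trans he')
  have hbelow : BddBelow {t | (planSchedule N l).work (i, ℓ) t = ω.jobs[i].tasks[ℓ].size} := by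
    refine ⟨0, fun t ht => le_of_not_gt fun hneg => ?_⟩
    rw [Set.mem_ofPred_eq, Schedule.work_eq_zero _ _ fun s h0 hst => by linarith] at ht
    exact (Task.size_pos _).ne ht
  exact (csInf_le hbelow (hl.planSchedule_work_eq_size he hT)).trans (e.taskStart_le_finish _)

theorem optCost_le_planCost (hl : Fits N a b l) (hω : ω.jobs = l.map Entry.job) :
    optCost N ω ≤ planCost l := by
  have hlen : ω.jobs.length = l.length := by rw [hω, List.length_map]
  refine (hl.feasible_planSchedule hω).optCost_le.trans ?_
  rw [planCost, ← Fin.sum_univ_fun_getElem, ← (finCongr hlen).sum_comp]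
  refine Finset.sum_le_sum fun i _ => sub_le_sub ?_ (le_of_eq ?_)
  · exact hl.jobCompletion_planSchedule_le hω (by simp)
  · simp [hω]

end Fits

/-! ### The jobs of the adversary -/

/-- A job with a single task. -/
def singleJob (r : ℕ) (p : ℝ) (hp : 0 < p) (preemptive : Bool) : Job :=
  ⟨r, r.cast_nonneg, [⟨p, hp, preemptive⟩], List.cons_ne_nil _ _⟩

/-- A preemptive job of unit size. -/
abbrev unitJob (r : ℕ) : Job := singleJob r 1 one_pos true

section

variable (r : ℕ) {p : ℝ} (hp : 0 < p) (preemptive : Bool)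

@[simp] theorem singleJob_release : (singleJob r p hp preemptive).release = r := rfl

@[simp] theorem singleJob_headSize : (singleJob r p hp preemptive).headSize = p := rfl

@[simp] theorem singleJob_workload : (singleJob r p hp preemptive).workload = p := by
  simp [Job.workload, singleJob]

end

/-- The conditions on the jobs of an instance with parameters `α` and `β` and minimum workload
`1`; the adversary only uses integral release dates. -/
structure Job.Admissible (α β : ℝ) (J : Job) : Prop where
  one_le_workload : 1 ≤ J.workload
  workload_le : J.workload ≤ α
  size_le : ∀ T ∈ J.tasks, T.preemptive = false → T.size ≤ β
  exists_release_eq : ∃ n : ℕ, J.release = n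

/-- An admissible job that attains both parameters `α` and `β`. -/
structure Job.IsExtremal (α β : ℝ) (J : Job) : Prop extends J.Admissible α β where
  workload_eq : J.workload = α
  exists_size_eq : 0 < β → ∃ T ∈ J.tasks, T.preemptive = false ∧ T.size = β

section

variable {α β : ℝ}

theorem singleJob_admissible (r : ℕ) {p : ℝ} (hp : 0 < p) {preemptive : Bool} (h1 : 1 ≤ p)
    (hα : p ≤ α) (hβ : preemptive = false → p ≤ β) :
    (singleJob r p hp preemptive).Admissible α β where
  one_le_workload := by rwa [singleJob_workload]
  workload_le := by rwa [singleJob_workload]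
  size_le T hT := by
    obtain rfl := List.mem_singleton.1 hT
    exact hβ
  exists_release_eq := ⟨r, rfl⟩

theorem unitJob_admissible (hα : 1 ≤ α) (r : ℕ) : (unitJob r).Admissible α β :=
  singleJob_admissible r one_pos le_rfl hα (by simp)

theorem Job.exists_isExtremal (r : ℕ) (hα : 1 ≤ α) (hβ : 0 ≤ β) (hβα : β ≤ α) :
    ∃ J : Job, J.release = r ∧ J.IsExtremal α β := by
  have hα' : 0 < α := by linarith
  rcases hβ.eq_or_lt with rfl | hβ
  · refine ⟨singleJob r α hα' true, rfl, singleJob_admissible r hα' hα le_rfl (by simp), ?_, ?_⟩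
    · exact singleJob_workload ..
    · exact fun h => absurd h (lt_irrefl 0)
  rcases hβα.eq_or_lt with rfl | hβα
  · refine ⟨singleJob r β hα' false, rfl,
      singleJob_admissible r hα' hα le_rfl fun _ => le_rfl, ?_, fun _ => ⟨⟨β, hα', false⟩, ?_⟩⟩
    · exact singleJob_workload ..
    · simp [singleJob]
  · let J : Job := ⟨r, r.cast_nonneg, [⟨β, hβ, false⟩, ⟨α - β, sub_pos.2 hβα, true⟩], by simp⟩
    have hJ : J.workload = α := by simp [J, Job.workload]
    exact ⟨J, rfl, ⟨hJ ▸ hα, hJ.le, by simp [J], r, rfl⟩, hJ, fun _ => by simp [J]⟩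

theorem Instance.parameters (hβ : 0 ≤ β) {ω : Instance} (h : ∀ J ∈ ω.jobs, J.Admissible α β)
    {r : ℕ} (hunit : unitJob r ∈ ω.jobs) {E : Job} (hE : E ∈ ω.jobs) (hext : E.IsExtremal α β) :
    ω.alpha = α ∧ ω.beta = β := by
  have hmin : ω.minWorkload = 1 := by
    refine IsLeast.csInf_eq ⟨⟨_, hunit, (singleJob_workload ..).symm⟩, ?_⟩
    rintro x ⟨J, hJ, rfl⟩
    exact (h J hJ).one_le_workload
  have hmax : ω.maxWorkload = α := by
    refine IsGreatest.csSup_eq ⟨⟨E, hE, hext.workload_eq.symm⟩, ?_⟩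
    rintro x ⟨J, hJ, rfl⟩
    exact (h J hJ).workload_le
  have heta : ω.eta = β := by
    rcases hβ.eq_or_lt with rfl | hβ
    · refine (congrArg sSup (Set.eq_empty_of_forall_notMem ?_)).trans Real.sSup_empty
      rintro x ⟨J, hJ, T, hT, hpre, -⟩
      exact T.size_pos.not_ge ((h J hJ).size_le T hT hpre)
    · obtain ⟨T, hT, hpre, rfl⟩ := hext.exists_size_eq hβ
      refine IsGreatest.csSup_eq ⟨⟨E, hE, T, hT, hpre, rfl⟩, ?_⟩
      rintro x ⟨J, hJ, T', hT', hpre', rfl⟩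
      exact (h J hJ).size_le T' hT' hpre'
  rw [Instance.alpha, Instance.beta, hmin, hmax, heta, div_one, div_one]
  exact ⟨rfl, rfl⟩

end

/-- The jobs of `l` are listed in the order of release and are released between `a` and `b`. -/
structure ReleasedWithin (a b : ℝ) (l : List Job) : Prop where
  mem_Icc : ∀ J ∈ l, J.release ∈ Set.Icc a b
  sorted : l.Pairwise fun J J' => J.release ≤ J'.release

namespace ReleasedWithin

variable {a b c : ℝ} {l l' : List Job}

theorem nil : ReleasedWithin a b [] := by
  constructor <;> simp

theorem mono {a' b' : ℝ} (h : ReleasedWithin a b l) (ha : a' ≤ a) (hb : b ≤ b') :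
    ReleasedWithin a' b' l :=
  ⟨fun J hJ => Set.Icc_subset_Icc ha hb (h.mem_Icc J hJ), h.sorted⟩

theorem of_forall_eq (h : ∀ J ∈ l, J.release = a) : ReleasedWithin a a l where
  mem_Icc J hJ := by simp [h J hJ]
  sorted := List.pairwise_of_forall_mem_list fun J hJ J' hJ' => by rw [h J hJ, h J' hJ']

theorem append (h : ReleasedWithin a b l) (h' : ReleasedWithin b c l') (hab : a ≤ b)
    (hbc : b ≤ c) : ReleasedWithin a c (l ++ l') where
  mem_Icc := List.forall_mem_append.2
    ⟨(h.mono le_rfl hbc).mem_Icc, (h'.mono hab le_rfl).mem_Icc⟩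
  sorted := List.pairwise_append.2 ⟨h.sorted, h'.sorted, fun J hJ J' hJ' =>
    (h.mem_Icc J hJ).2.trans (h'.mem_Icc J' hJ').1⟩

theorem flatMap_range {s : ℕ → ℝ} (hs : Monotone s) {f : ℕ → List Job} {k : ℕ}
    (h : ∀ j < k, ReleasedWithin (s j) (s (j + 1)) (f j)) :
    ReleasedWithin (s 0) (s k) ((List.range k).flatMap f) := by
  induction k with
  | zero => exact nil
  | succ k ih =>
    rw [List.range_succ, List.flatMap_append, List.flatMap_singleton]
    exact (ih fun j hj => h j (hj.trans k.lt_succ_self)).append (h k k.lt_succ_self)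
      (hs k.zero_le) (hs k.le_succ)

end ReleasedWithin

/-- The plan that starts the jobs of `l` at the times `s, s + w, …, s + (d - 1) * w`, with `d` jobs
on each machine from number `a` on. -/
def gridPlan (l : List Job) (s w : ℝ) (a d : ℕ) : List Entry :=
  l.mapIdx fun u J => ⟨J, a + u / d, s + (u % d : ℕ) * w⟩

section

variable (l : List Job) (s w : ℝ) (a d : ℕ)

@[simp] theorem map_job_gridPlan : (gridPlan l s w a d).map Entry.job = l := by
  rw [gridPlan, List.mapIdx_eq_zipIdx_map, List.map_map]
  exact List.zipIdx_map_fst 0 l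

@[simp] theorem length_gridPlan : (gridPlan l s w a d).length = l.length :=
  List.length_mapIdx

end

theorem fits_gridPlan {l : List Job} {s w : ℝ} {a d : ℕ} (hw : 0 ≤ w)
    (hl : ∀ J ∈ l, J.release ≤ s ∧ J.workload ≤ w) (hlen : l.length ≤ (N - a) * d) :
    Fits N s (s + d * w) (gridPlan l s w a d) := by
  have hentry (e : Entry) (he : e ∈ gridPlan l s w a d) : ∃ u < l.length,
      e.job ∈ l ∧ e.machine = a + u / d ∧ e.start = s + (u % d : ℕ) * w := by
    obtain ⟨u, hu, rfl⟩ := List.mem_mapIdx.1 he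
    exact ⟨u, hu, List.getElem_mem hu, rfl, rfl⟩
  have hrow {u v : ℕ} (huv : u < v) : (u : ℝ) * w + w ≤ v * w := by
    have hle : (u : ℝ) + 1 ≤ v := by exact_mod_cast huv
    linarith [mul_le_mul_of_nonneg_right hle hw]
  have hstart (e : Entry) (he : e ∈ gridPlan l s w a d) : s ≤ e.start := by
    obtain ⟨u, -, -, -, h⟩ := hentry e he
    exact h ▸ le_add_of_nonneg_right (mul_nonneg (Nat.cast_nonneg _) hw)
  refine ⟨hstart, fun e he => ?_, fun e he => ?_, fun e he => ?_,
    List.pairwise_iff_getElem.2 fun i j hi hj hij => ?_⟩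
  · obtain ⟨u, -, hJ, -⟩ := hentry e he
    exact (hl _ hJ).1.trans (hstart e he)
  · obtain ⟨u, hu, hJ, -, h⟩ := hentry e he
    have hd : 0 < d := Nat.pos_of_mul_pos_left ((Nat.zero_le u).trans_lt (hu.trans_le hlen))
    rw [Entry.finish, h]
    linarith [hrow (u.mod_lt hd), (hl _ hJ).2]
  · obtain ⟨u, hu, -, h, -⟩ := hentry e he
    have hrowlt := Nat.div_lt_of_lt_mul ((hu.trans_le hlen).trans_eq (mul_comm _ _))
    exact h.trans_lt (Nat.lt_sub_iff_add_lt'.1 hrowlt)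
  · rw [length_gridPlan] at hi hj
    simp only [gridPlan, List.getElem_mapIdx, Entry.Compatible, Entry.finish]
    by_cases hdiv : i / d = j / d
    · have hmod : i % d < j % d := by
        have hi' := Nat.div_add_mod i d
        have hj' := Nat.div_add_mod j d
        rw [hdiv] at hi'
        omega
      exact Or.inr (Or.inl (by linarith [hrow hmod, (hl _ (List.getElem_mem hi)).2]))
    · exact Or.inl (by omega)

theorem fits_gridPlan_one {l : List Job} {T M : ℕ} (hT : ∀ J ∈ l, J.release ≤ T)
    (hM : ∀ J ∈ l, J.workload ≤ M) (hlen : l.length ≤ N) :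
    Fits N T (T + M : ℕ) (gridPlan l T M 0 1) := by
  have h := fits_gridPlan (N := N) (a := 0) (d := 1) M.cast_nonneg
    (fun J hJ => ⟨hT J hJ, hM J hJ⟩) (by rwa [Nat.sub_zero, mul_one])
  simpa only [Nat.cast_one, one_mul, Nat.cast_add] using h

/-- A stream of jobs: `N` unit jobs at each of the times `T, …, T + L - 1`. -/
def stream (N T L : ℕ) : List Job :=
  (List.range L).flatMap fun s => List.replicate N (unitJob (T + s))

/-- The plan that processes each job of the stream at its release. -/
def streamPlan (N T L : ℕ) : List Entry :=
  (List.range L).flatMap fun s => gridPlan (List.replicate N (unitJob (T + s))) (T + s : ℕ) 1 0 1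

section

variable {T L : ℕ}

theorem mem_stream {J : Job} : J ∈ stream N T L ↔ N ≠ 0 ∧ ∃ s < L, J = unitJob (T + s) := by
  simp only [stream, List.mem_flatMap, List.mem_range, List.mem_replicate]
  grind

theorem stream_sublist {s l : ℕ} (hT : T ≤ s) (hL : s + l ≤ T + L) :
    stream N s l <+ stream N T L := by
  obtain ⟨a, rfl⟩ := Nat.exists_eq_add_of_le hT
  obtain ⟨b, rfl⟩ : ∃ b, L = a + l + b := Nat.exists_eq_add_of_le (by omega)
  simp only [stream, List.range_add, List.flatMap_append, List.flatMap_map, add_assoc]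
  exact (List.sublist_append_left _ _).trans (List.sublist_append_right _ _)

@[simp] theorem length_stream : (stream N T L).length = L * N := by
  simp [stream, List.length_flatMap]

theorem sum_headSize_stream : ((stream N T L).map Job.headSize).sum = L * N := by
  have hunit (x : ℝ) (hx : x ∈ (stream N T L).map Job.headSize) : x = 1 := by
    obtain ⟨J, hJ, rfl⟩ := List.mem_map.1 hx
    obtain ⟨-, s, -, rfl⟩ := mem_stream.1 hJ
    exact singleJob_headSize ..
  rw [List.sum_eq_card_nsmul _ 1 hunit, List.length_map, length_stream, nsmul_one, Nat.cast_mul]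

theorem releasedWithin_stream : ReleasedWithin T (T + L : ℕ) (stream N T L) := by
  refine ReleasedWithin.flatMap_range (s := fun s => ((T + s : ℕ) : ℝ))
    (fun s s' h => by simpa using h) fun s _ => ?_
  refine (ReleasedWithin.of_forall_eq fun J hJ => ?_).mono le_rfl (by simp)
  rw [List.eq_of_mem_replicate hJ, singleJob_release]

@[simp] theorem map_job_streamPlan : (streamPlan N T L).map Entry.job = stream N T L := by
  simp [streamPlan, stream, List.map_flatMap]

theorem fits_gridPlan_replicate_unitJob (n r : ℕ) {a d : ℕ} (h : n ≤ (N - a) * d) :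
    Fits N r (r + d : ℕ) (gridPlan (List.replicate n (unitJob r)) r 1 a d) := by
  rw [Nat.cast_add, ← mul_one (d : ℝ)]
  refine fits_gridPlan zero_le_one (fun J hJ => ?_) (by simpa using h)
  simp [List.eq_of_mem_replicate hJ]

theorem fits_streamPlan : Fits N T (T + L : ℕ) (streamPlan N T L) :=
  Fits.flatMap_range (s := fun s => ((T + s : ℕ) : ℝ)) (fun s s' h => by simpa using h)
    fun s _ => fits_gridPlan_replicate_unitJob N (T + s) (by rw [Nat.sub_zero, mul_one])

theorem planCost_streamPlan_le : planCost (streamPlan N T L) ≤ L * N := by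
  refine (planCost_le_length_mul (K := 1) fun e he => ?_).trans_eq ?_
  · obtain ⟨s, -, hs⟩ := List.mem_flatMap.1 he
    have hfinish := (fits_gridPlan_replicate_unitJob (N := N) N (T + s) (by simp)).finish_le e hs
    have hjob : e.job = unitJob (T + s) := by
      have := List.mem_map_of_mem (f := Entry.job) hs
      rw [map_job_gridPlan] at this
      exact List.eq_of_mem_replicate this
    rw [hjob, singleJob_release]
    push_cast at hfinish ⊢
    linarith
  · have := congrArg List.length (map_job_streamPlan (N := N) (T := T) (L := L))
    rw [List.length_map, length_stream] at this
    rw [this]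
    push_cast
    ring

theorem Feasible.backlog_le_backlog_of_stream {ω : Instance} {σ : Schedule N}
    (hσ : Feasible ω σ) {C : Set ℝ} (hC : 1 ∈ C) (h : stream N T L <+ ω.jobs) :
    backlog ω σ C T ≤ backlog ω σ C (T + L : ℕ) := by
  have hle : (T : ℝ) ≤ (T + L : ℕ) := by simp
  have hold := hσ.backlog_add_arrivals_le C T.cast_nonneg hle
  have harr : (L * N : ℝ) ≤ arrivals ω.jobs C T (T + L : ℕ) := by
    refine sum_headSize_stream.symm.trans_le (sum_headSize_le_arrivals h fun J hJ => ?_)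
    obtain ⟨-, s, hs, rfl⟩ := mem_stream.1 hJ
    exact ⟨by simpa using hs, hC⟩
  push_cast at *
  linarith

end

/-! ### Lower bounds on the competitive ratio -/

/-- The plan for an instance of the adversary: the jobs of `X` as planned until time `T`, then the
stream, then the delayed jobs `D` and a last job `E`. The jobs are listed in the order of
release. -/
def adversaryPlan (N : ℕ) (X : List Entry) (D : List Job) (T L M : ℕ) (E : Job) : List Entry :=
  X ++ gridPlan D (T + L : ℕ) M 0 1 ++ streamPlan N T L ++ gridPlan [E] (T + L + M : ℕ) M 0 1

section

variable {X : List Entry} {D : List Job} {E : Job} {T L M : ℕ}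

@[simp] theorem map_job_adversaryPlan : (adversaryPlan N X D T L M E).map Entry.job =
    X.map Entry.job ++ D ++ stream N T L ++ [E] := by
  simp [adversaryPlan]

theorem releasedWithin_adversaryPlan (hrel : ReleasedWithin 0 T (X.map Entry.job ++ D))
    (hE : E.release = (T + L + M : ℕ)) :
    ReleasedWithin 0 (T + L + M : ℕ) ((adversaryPlan N X D T L M E).map Entry.job) := by
  rw [map_job_adversaryPlan]
  exact (hrel.append releasedWithin_stream T.cast_nonneg (by simp)).append
    ((ReleasedWithin.of_forall_eq (by simpa using hE)).mono (by simp) le_rfl)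
    (Nat.cast_nonneg _) (by simp)

theorem fits_adversaryPlan (hX : Fits N 0 T X) (hDT : ∀ J ∈ D, J.release ≤ T)
    (hDM : ∀ J ∈ D, J.workload ≤ M) (hD : D.length ≤ N) (hE : E.release = (T + L + M : ℕ))
    (hEM : E.workload ≤ M) (hN : 0 < N) :
    Fits N 0 (T + L + M + M : ℕ) (adversaryPlan N X D T L M E) := by
  have hdelayed : Fits N (T + L : ℕ) (T + L + M : ℕ) (gridPlan D (T + L : ℕ) M 0 1) :=
    fits_gridPlan_one (fun J hJ => (hDT J hJ).trans (by simp)) hDM hD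
  have hlast : Fits N (T + L + M : ℕ) (T + L + M + M : ℕ)
      (gridPlan [E] (T + L + M : ℕ) M 0 1) :=
    fits_gridPlan_one (by simp [hE]) (by simpa using hEM) hN
  refine (((hX.append fits_streamPlan T.cast_nonneg (by simp)).append hdelayed
    (Nat.cast_nonneg _) (by simp)).append hlast (Nat.cast_nonneg _) (by simp)).perm ?_
  simp only [adversaryPlan, List.append_assoc]
  exact (List.perm_append_comm_assoc ..).append_left X

theorem planCost_adversaryPlan_le (hDT : ∀ J ∈ D, J.release ≤ T)
    (hDM : ∀ J ∈ D, J.workload ≤ M) (hD : D.length ≤ N) (hE : E.release = (T + L + M : ℕ))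
    (hEM : E.workload ≤ M) (hN : 0 < N) :
    planCost (adversaryPlan N X D T L M E) ≤ planCost X + N * (T + M) + M + 2 * N * L := by
  have hdelayed := (fits_gridPlan_one (T := T + L) (fun J hJ => (hDT J hJ).trans (by simp)) hDM
    hD).planCost_le (r := 0) fun J _ => J.release_nonneg
  have hlast := (fits_gridPlan_one (l := [E]) (T := T + L + M) (by simp [hE]) (by simpa using hEM)
    hN).planCost_le (r := (T + L + M : ℕ)) (by simp [hE])
  have hstream := planCost_streamPlan_le (N := N) (T := T) (L := L)
  have hcount : (D.length : ℝ) * (T + L + M) ≤ N * (T + L + M) := by gcongr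
  simp only [adversaryPlan, planCost_append]
  simp only [length_gridPlan, List.length_singleton] at hdelayed hlast
  push_cast at *
  linarith

end

theorem exists_instance_optCost_le {α β : ℝ} {X : List Entry} {D : List Job} {T L : ℕ}
    (hN : 0 < N) (hα : 1 ≤ α) (hβ : 0 ≤ β) (hβα : β ≤ α) (hX : Fits N 0 T X)
    (hrel : ReleasedWithin 0 T (X.map Entry.job ++ D))
    (hadm : ∀ J ∈ X.map Entry.job ++ D, J.Admissible α β) (hD : D.length ≤ N) (hL : 0 < L) :
    ∃ ω : Instance, (∀ J ∈ ω.jobs, J.Admissible α β) ∧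
      ω.Continues (X.map Entry.job ++ D ++ stream N T L) (T + L : ℕ) ∧
      (ω.alpha = α ∧ ω.beta = β) ∧
      optCost N ω ≤ planCost X + N * (T + ⌈α⌉₊) + ⌈α⌉₊ + 2 * N * L := by
  obtain ⟨E, hE, hext⟩ := Job.exists_isExtremal (T + L + ⌈α⌉₊) hα hβ hβα
  have hM {J : Job} (hJ : J.Admissible α β) : J.workload ≤ ⌈α⌉₊ :=
    hJ.workload_le.trans (Nat.le_ceil α)
  have hDT : ∀ J ∈ D, J.release ≤ T := fun J hJ =>
    (hrel.mem_Icc J (List.mem_append_right _ hJ)).2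
  have hDM : ∀ J ∈ D, J.workload ≤ ⌈α⌉₊ := fun J hJ => hM (hadm J (List.mem_append_right _ hJ))
  let plan := adversaryPlan N X D T L ⌈α⌉₊ E
  have hjobs : plan.map Entry.job = X.map Entry.job ++ D ++ stream N T L ++ [E] :=
    map_job_adversaryPlan
  let ω : Instance := ⟨plan.map Entry.job, by simp [hjobs],
    (releasedWithin_adversaryPlan hrel hE).sorted⟩
  have hall : ∀ J ∈ ω.jobs, J.Admissible α β := by
    change ∀ J ∈ plan.map Entry.job, J.Admissible α β
    rw [hjobs]
    refine List.forall_mem_append.2 ⟨List.forall_mem_append.2 ⟨hadm, fun J hJ => ?_⟩,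
      List.forall_mem_singleton.2 hext.toAdmissible⟩
    obtain ⟨-, s, -, rfl⟩ := mem_stream.1 hJ
    exact unitJob_admissible hα _
  have hunit : unitJob (T + 0) ∈ ω.jobs := by
    have : unitJob (T + 0) ∈ stream N T L := mem_stream.2 ⟨hN.ne', 0, hL, rfl⟩
    simp only [ω, hjobs, List.mem_append, this, or_true, true_or]
  refine ⟨ω, hall, ⟨[E], hjobs, by simp [hE]⟩,
    ω.parameters hβ hall hunit (by simp [ω, hjobs]) hext, ?_⟩
  exact ((fits_adversaryPlan hX hDT hDM hD hE (hM hext.toAdmissible) hN).optCost_le_planCost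
    rfl).trans (planCost_adversaryPlan_le hDT hDM hD hE (hM hext.toAdmissible) hN)

namespace OnlineAlgorithm

variable (A : OnlineAlgorithm N) {α β : ℝ}

theorem le_competitiveRatio {ω : Instance} (h : ω.alpha = α ∧ ω.beta = β) :
    ((totalResponse ω (A.schedule ω) / optCost N ω : ℝ) : EReal) ≤ A.competitiveRatio α β :=
  le_iSup₂ (f := fun (ω : Instance) (_ : ω.alpha = α ∧ ω.beta = β) =>
    ((totalResponse ω (A.schedule ω) / optCost N ω : ℝ) : EReal)) ω h

theorem one_le_competitiveRatio (hα : 1 ≤ α) (hβ : 0 ≤ β) (hβα : β ≤ α) :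
    1 ≤ A.competitiveRatio α β := by
  obtain ⟨E, hE, hext⟩ := Job.exists_isExtremal 0 hα hβ hβα
  let ω : Instance := ⟨[unitJob 0, E], by simp, by simp [hE]⟩
  have hadm : ∀ J ∈ ω.jobs, J.Admissible α β := by
    simp [ω, unitJob_admissible hα, hext.toAdmissible]
  refine le_trans ?_ (A.le_competitiveRatio
    (ω.parameters hβ hadm (r := 0) (by simp [ω]) (E := E) (by simp [ω]) hext))
  rw [← EReal.coe_one, EReal.coe_le_coe_iff, one_le_div (A.feasible ω).optCost_pos]
  exact (A.feasible ω).optCost_le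

theorem div_le_competitiveRatio_of_eventually {a b c d : ℝ} (ha : 0 < a)
    (h : ∀ᶠ L : ℕ in Filter.atTop, ∃ ω : Instance, (ω.alpha = α ∧ ω.beta = β) ∧
      optCost N ω ≤ b + a * L ∧ d + c * L ≤ totalResponse ω (A.schedule ω)) :
    ((c / a : ℝ) : EReal) ≤ A.competitiveRatio α β := by
  refine le_of_tendsto (EReal.tendsto_coe.2
    (tendsto_add_mul_div_add_mul_atTop_nhds d b c ha.ne')) (h.mono fun L hL => ?_)
  obtain ⟨ω, hpar, hopt, hcost⟩ := hL
  have hpos := (A.feasible ω).optCost_pos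
  refine le_trans ?_ (A.le_competitiveRatio hpar)
  rw [EReal.coe_le_coe_iff]
  calc (d + c * L) / (b + a * L) ≤ totalResponse ω (A.schedule ω) / (b + a * L) :=
        div_le_div_of_nonneg_right hcost (hpos.le.trans hopt)
    _ ≤ totalResponse ω (A.schedule ω) / optCost N ω :=
        div_le_div_of_nonneg_left (hpos.le.trans (A.feasible ω).optCost_le) hpos hopt

theorem div_le_competitiveRatio_of_pending {X : List Entry} {D : List Job} {T K : ℕ} {B : ℝ}
    (hN : 0 < N) (hα : 1 ≤ α) (hβ : 0 ≤ β) (hβα : β ≤ α) (hX : Fits N 0 T X)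
    (hrel : ReleasedWithin 0 T (X.map Entry.job ++ D))
    (hadm : ∀ J ∈ X.map Entry.job ++ D, J.Admissible α β) (hD : D.length ≤ N)
    (hpend : ∀ (L : ℕ) (ω : Instance),
      ω.Continues (X.map Entry.job ++ D ++ stream N T L) (T + L : ℕ) →
        ∀ t : ℕ, K < t → t ≤ T + L → B ≤ #(pending ω (A.schedule ω) t)) :
    ((B / (2 * N) : ℝ) : EReal) ≤ A.competitiveRatio α β := by
  refine A.div_le_competitiveRatio_of_eventually (d := B * (T - K))
    (b := planCost X + N * (T + ⌈α⌉₊) + ⌈α⌉₊) (by positivity)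
    ((Filter.eventually_gt_atTop K).mono fun L hL => ?_)
  obtain ⟨ω, hall, hω, hpar, hopt⟩ := exists_instance_optCost_le hN hα hβ hβα hX hrel hadm hD
    ((Nat.zero_le K).trans_lt hL)
  refine ⟨ω, hpar, hopt, ?_⟩
  calc B * (T - K) + B * L = (T + L - K : ℕ) * B := by
        rw [Nat.cast_sub (by omega)]
        push_cast
        ring
    _ ≤ ∑ t ∈ Finset.Ioc K (T + L), (#(pending ω (A.schedule ω) t) : ℝ) := by
        rw [← Nat.card_Ioc, ← nsmul_eq_mul]
        exact Finset.card_nsmul_le_sum _ _ _ fun t ht =>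
          hpend L ω hω t (Finset.mem_Ioc.1 ht).1 (Finset.mem_Ioc.1 ht).2
    _ ≤ totalResponse ω (A.schedule ω) :=
        (A.feasible ω).sum_card_pending_le (fun J hJ => (hall J hJ).exists_release_eq) K (T + L)

end OnlineAlgorithm

/-! ### The bound in terms of β -/

theorem arrivals_le_backlog {ω : Instance} {σ : Schedule N} {C : Set ℝ} {t : ℝ}
    (h : ∀ i ∈ ω.arrived C t, σ.work (i, 0) t = 0) :
    arrivals ω.jobs C 0 t ≤ backlog ω σ C t := by
  classical
  rw [ω.arrivals_eq_sum]
  calc ∑ i ∈ ω.arrived C t \ ω.arrived C 0, ω.jobs[i].headSize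
      ≤ ∑ i ∈ ω.arrived C t, ω.jobs[i].headSize :=
        Finset.sum_le_sum_of_subset_of_nonneg Finset.sdiff_subset
          fun i _ _ => ω.jobs[i].headSize_pos.le
    _ = backlog ω σ C t := Finset.sum_congr rfl fun i hi => by rw [h i hi, sub_zero]

theorem WorkConservingSchedule.ne_none {ω : Instance} {σ : Schedule N}
    (hw : WorkConservingSchedule ω σ) {t : ℝ} {τ : Fin N → ℕ × ℕ} (hτ : Function.Injective τ)
    (havail : ∀ i, ∃ J T, ω.HasTask (τ i) J T ∧ J.release ≤ t ∧ σ.work (τ i) t < T.size)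
    (m : Fin N) : σ m t ≠ none := by
  intro hidle
  have hrun (i : Fin N) : ∃ m', σ m' t = some (τ i) := by
    obtain ⟨J, T, hJT, hrel, hwork⟩ := havail i
    exact hw t ⟨m, hidle⟩ _ J T hJT hrel hwork
  choose machine hmachine using hrun
  have hinj : Function.Injective machine := fun i j hij =>
    hτ (Option.some.inj ((hmachine i).symm.trans (hij ▸ hmachine j)))
  obtain ⟨i, rfl⟩ := Finite.surjective_of_injective hinj m
  exact Option.some_ne_none _ ((hmachine i).symm.trans hidle)

theorem Feasible.eq_some_of_nonpreemptive {ω : Instance} {σ : Schedule N} (hσ : Feasible ω σ)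
    {τ : ℕ × ℕ} {J : Job} {T : Task} (h : ω.HasTask τ J T) (hT : T.preemptive = false)
    {m : Fin N} (hm : σ m J.release = some τ) {t : ℝ}
    (ht : t ∈ Set.Ico J.release (J.release + T.size)) : σ m t = some τ := by
  obtain ⟨m', s, hs⟩ := hσ.nonpreemptive τ J T h hT
  obtain ⟨rfl, hsr, -⟩ := (hs m J.release).1 hm
  obtain ⟨J', T', hJ', hrs⟩ :=
    hσ.released m τ s ((hs m s).2 ⟨rfl, le_rfl, by linarith [T.size_pos]⟩)
  obtain rfl : J = J' := Option.some.inj (h.1.symm.trans hJ'.1)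
  exact (hs m t).2 ⟨rfl, hsr.trans ht.1, by linarith [ht.2]⟩

section

variable {β : ℝ} {hβ : 0 < β} {ω : Instance} {σ : Schedule N} {s : ℝ}

theorem WorkConservingSchedule.eq_some_of_continues (hw : WorkConservingSchedule ω σ)
    (hσ : Feasible ω σ)
    (hω : ω.Continues (List.replicate N (singleJob 0 β hβ false)) s) (hs : 0 < s) (m : Fin N) :
    ∃ i < N, ∀ t ∈ Set.Ico 0 β, σ m t = some (i, 0) := by
  obtain ⟨Y, hjobs, hY⟩ := hω
  have htask {i : ℕ} (hi : i < N) :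
      ω.HasTask (i, 0) (singleJob 0 β hβ false) ⟨β, hβ, false⟩ := by
    simp [Instance.HasTask, hjobs, singleJob, List.getElem?_append, hi]
  have hbusy : σ m 0 ≠ none := by
    refine hw.ne_none (τ := fun i => (i.val, 0))
      (fun i j hij => Fin.ext (Prod.ext_iff.1 hij).1) (fun i => ⟨_, _, htask i.2, ?_, ?_⟩) m
    · simp
    · rwa [hσ.work_eq_zero_of_le_release (htask i.2).1 (by simp)]
  obtain ⟨⟨i, ℓ⟩, hm⟩ := Option.ne_none_iff_exists'.1 hbusy
  obtain ⟨J, T, hJT, hrel⟩ := hσ.released m _ 0 hm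
  have hi : i < N := by
    by_contra! hi
    have hJ : Y[i - N]? = some J := by
      simpa [hjobs, List.getElem?_append_right, hi] using hJT.1
    linarith [hY J (List.mem_of_getElem? hJ)]
  obtain rfl : singleJob 0 β hβ false = J := Option.some.inj ((htask hi).1.symm.trans hJT.1)
  obtain rfl : ℓ = 0 := by
    simpa [singleJob] using (List.getElem?_eq_some_iff.1 hJT.2).1
  refine ⟨i, hi, fun t ht => hσ.eq_some_of_nonpreemptive (htask hi) rfl (by simpa using hm) ?_⟩
  simpa using ht

theorem WorkConservingSchedule.arrivals_le_backlog (hw : WorkConservingSchedule ω σ)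
    (hσ : Feasible ω σ)
    (hω : ω.Continues (List.replicate N (singleJob 0 β hβ false)) s) (hs : 0 < s) {t : ℝ}
    (ht : t ≤ β) {C : Set ℝ} (hC : β ∉ C) : arrivals ω.jobs C 0 t ≤ backlog ω σ C t := by
  refine MPMS.arrivals_le_backlog fun i hi => σ.work_eq_zero _ fun u hu hut => ?_
  rintro ⟨m, hm⟩
  obtain ⟨j, hj, hrun⟩ := hw.eq_some_of_continues hσ hω hs m
  obtain rfl : j = i.val :=
    (Prod.ext_iff.1 (Option.some.inj ((hrun u ⟨hu, hut.trans_le ht⟩).symm.trans hm))).1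
  obtain ⟨Y, hjobs, -⟩ := hω
  have hsize : ω.jobs[i].headSize = β := by
    simp [hjobs, hj]
  have hmem := (Instance.mem_arrived.1 hi).2
  rw [hsize] at hmem
  exact hC hmem

theorem WorkConservingSchedule.mul_le_backlog_of_stream (hw : WorkConservingSchedule ω σ)
    (hσ : Feasible ω σ) (hω : ω.Continues (List.replicate N (singleJob 0 β hβ false)) 1)
    (hβ1 : 1 < β) {l : ℕ} (hl : 1 + l ≤ β) (hstream : stream N 1 l <+ ω.jobs) :
    (l * N : ℝ) ≤ backlog ω σ (Set.Iic 1) (1 + l : ℕ) := by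
  calc (l * N : ℝ) ≤ arrivals ω.jobs (Set.Iic 1) 0 (1 + l : ℕ) := by
        refine sum_headSize_stream.symm.trans_le (sum_headSize_le_arrivals hstream fun J hJ => ?_)
        obtain ⟨-, u, hu, rfl⟩ := mem_stream.1 hJ
        exact ⟨⟨Job.release_nonneg _, by simpa using hu⟩, by simp⟩
    _ ≤ backlog ω σ (Set.Iic 1) (1 + l : ℕ) :=
        hw.arrivals_le_backlog hσ hω one_pos (by exact_mod_cast hl) (by simpa using hβ1)

end

theorem OnlineAlgorithm.WorkConserving.div_six_le_competitiveRatio {A : OnlineAlgorithm N}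
    (hA : A.WorkConserving) (hN : 0 < N) {α β : ℝ} (hβ : 2 ≤ β) (hβα : β ≤ α) :
    ((β / 6 : ℝ) : EReal) ≤ A.competitiveRatio α β := by
  have hβ0 : 0 < β := by linarith
  have hfloor : 2 ≤ ⌊β⌋₊ := Nat.le_floor hβ
  obtain ⟨l, hl⟩ : ∃ l : ℕ, ⌊β⌋₊ = 1 + l := Nat.exists_eq_add_of_le (by omega)
  have hlβ : (1 + l : ℝ) ≤ β := by exact_mod_cast hl ▸ Nat.floor_le hβ0.le
  have hβl : β ≤ 3 * l := by
    have hl1 : (1 : ℝ) ≤ l := by exact_mod_cast (by omega : 1 ≤ l)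
    have hlt := Nat.lt_floor_add_one β
    rw [hl] at hlt
    push_cast at hlt
    linarith
  have hbound : β / 6 ≤ l * N / (2 * N) := by
    rw [mul_div_mul_right _ _ (by positivity)]
    linarith
  let big := List.replicate N (singleJob 0 β hβ0 false)
  refine (EReal.coe_le_coe_iff.2 hbound).trans
    (A.div_le_competitiveRatio_of_pending (X := []) (D := big) (T := 1) (K := 1 + l) hN
      (by linarith) hβ0.le hβα Fits.nil ?_ ?_ (by simp [big]) fun L ω hω t hlt htL => ?_)
  · exact (ReleasedWithin.of_forall_eq fun J hJ => by
      simp [List.eq_of_mem_replicate hJ]).mono le_rfl (by simp)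
  · intro J hJ
    rw [List.eq_of_mem_replicate hJ]
    exact singleJob_admissible 0 hβ0 (by linarith) hβα fun _ => le_rfl
  have hbig : ω.Continues big 1 := hω.of_append
    (fun J hJ => by simpa using (releasedWithin_stream.mem_Icc J hJ).1) (by simp)
  have hstream {r l : ℕ} (hr : 1 ≤ r) (hl : r + l ≤ 1 + L) : stream N r l <+ ω.jobs :=
    ((stream_sublist hr hl).trans (List.sublist_append_right _ _)).trans hω.sublist
  calc (l * N : ℝ) ≤ backlog ω (A.schedule ω) (Set.Iic 1) (1 + l : ℕ) :=
        (hA ω).mul_le_backlog_of_stream (A.feasible ω) hbig (by linarith) hlβ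
          (hstream le_rfl (by omega))
    _ ≤ backlog ω (A.schedule ω) (Set.Iic 1) (1 + l + (t - (1 + l)) : ℕ) :=
        (A.feasible ω).backlog_le_backlog_of_stream (by simp) (hstream (by omega) (by omega))
    _ ≤ #(pending ω (A.schedule ω) t) := by
        rw [Nat.add_sub_cancel' hlt.le]
        simpa using (A.feasible ω).backlog_Iic_le zero_le_one t

/-! ### The bound in terms of α -/

/-- The time at which phase `j` of the adversary starts, if each phase `i` takes time `2 * q i`. -/
def phaseStart (q : ℕ → ℕ+) (j : ℕ) : ℕ := ∑ i ∈ Finset.range j, 2 * (q i : ℕ)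

/-- The long job of phase `j`. -/
def longJob (q : ℕ → ℕ+) (j : ℕ) : Job :=
  singleJob (phaseStart q j) (2 * (q j : ℕ)) (by have := (q j).pos; positivity) true

/-- The jobs of phase `j`, all released at its start: one half of the machines suffices for the
unit jobs, and the other half for the long ones. -/
def phase (N : ℕ) (q : ℕ → ℕ+) (j : ℕ) : List Job :=
  List.replicate (N * q j) (unitJob (phaseStart q j)) ++ List.replicate (N / 2) (longJob q j)

/-- The jobs of the first `k` phases. -/
def phases (N : ℕ) (q : ℕ → ℕ+) (k : ℕ) : List Job := (List.range k).flatMap (phase N q)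

/-- The plan that completes phase `j` before the next one starts. -/
def phasePlan (N : ℕ) (q : ℕ → ℕ+) (j : ℕ) : List Entry :=
  gridPlan (List.replicate (N * q j) (unitJob (phaseStart q j))) (phaseStart q j) 1 (N / 2)
      (2 * q j) ++
    gridPlan (List.replicate (N / 2) (longJob q j)) (phaseStart q j) (2 * q j : ℕ) 0 1

/-- The plan that completes each of the first `k` phases before the next one starts. -/
def phasesPlan (N : ℕ) (q : ℕ → ℕ+) (k : ℕ) : List Entry := (List.range k).flatMap (phasePlan N q)

section

variable {q : ℕ → ℕ+}

@[simp] theorem phaseStart_zero : phaseStart q 0 = 0 := rfl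

theorem phaseStart_succ (j : ℕ) : phaseStart q (j + 1) = phaseStart q j + 2 * (q j : ℕ) :=
  Finset.sum_range_succ ..

theorem monotone_phaseStart : Monotone fun j => (phaseStart q j : ℝ) :=
  monotone_nat_of_le_succ fun j => by simp [phaseStart_succ]

theorem longJob_workload (j : ℕ) : (longJob q j).workload = 2 * (q j : ℕ) :=
  singleJob_workload ..

theorem longJob_headSize (j : ℕ) : (longJob q j).headSize = 2 * (q j : ℕ) := rfl

theorem longJob_admissible {α β : ℝ} {j : ℕ} (hα : 2 * (q j : ℕ) ≤ α) :
    (longJob q j).Admissible α β := by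
  have hq : (1 : ℝ) ≤ (q j : ℕ) := by exact_mod_cast (q j).pos
  exact singleJob_admissible _ _ (by linarith) hα (by simp)

theorem phases_succ (k : ℕ) : phases N q (k + 1) = phases N q k ++ phase N q k := by
  rw [phases, List.range_succ, List.flatMap_append, List.flatMap_singleton, phases]

theorem eq_of_mem_phase {j : ℕ} {J : Job} (h : J ∈ phase N q j) :
    J = unitJob (phaseStart q j) ∨ J = longJob q j :=
  (List.mem_append.1 h).imp List.eq_of_mem_replicate List.eq_of_mem_replicate

theorem release_of_mem_phase {j : ℕ} {J : Job} (h : J ∈ phase N q j) :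
    J.release = phaseStart q j := by
  rcases eq_of_mem_phase h with rfl | rfl <;> rfl

theorem exists_of_mem_phases {k : ℕ} {J : Job} (h : J ∈ phases N q k) :
    ∃ j < k, J = unitJob (phaseStart q j) ∨ J = longJob q j := by
  obtain ⟨j, hj, hJ⟩ := List.mem_flatMap.1 h
  exact ⟨j, List.mem_range.1 hj, eq_of_mem_phase hJ⟩

theorem admissible_of_mem_phases {α β : ℝ} (hα : 1 ≤ α) {k : ℕ}
    (hq : ∀ j < k, 2 * (q j : ℕ) ≤ α) : ∀ J ∈ phases N q k, J.Admissible α β := by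
  intro J hJ
  obtain ⟨j, hj, rfl | rfl⟩ := exists_of_mem_phases hJ
  · exact unitJob_admissible hα _
  · exact longJob_admissible (hq j hj)

theorem releasedWithin_phase (j : ℕ) :
    ReleasedWithin (phaseStart q j) (phaseStart q j) (phase N q j) :=
  ReleasedWithin.of_forall_eq fun _ => release_of_mem_phase

theorem releasedWithin_phases (k : ℕ) : ReleasedWithin 0 (phaseStart q k) (phases N q k) := by
  have h := ReleasedWithin.flatMap_range (k := k) monotone_phaseStart fun j _ =>
    (releasedWithin_phase (N := N) (q := q) j).mono le_rfl (monotone_phaseStart j.le_succ)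
  simpa [phases] using h

theorem sum_headSize_phase (j : ℕ) :
    ((phase N q j).map Job.headSize).sum = N * (q j : ℕ) + (N / 2 : ℕ) * (2 * (q j : ℕ)) := by
  simp [phase, longJob_headSize]

@[simp] theorem map_job_phasesPlan (k : ℕ) : (phasesPlan N q k).map Entry.job = phases N q k := by
  simp only [phasesPlan, phasePlan, phases, List.map_flatMap, List.map_append, map_job_gridPlan]
  rfl

theorem fits_phasePlan (j : ℕ) :
    Fits N (phaseStart q j) (phaseStart q (j + 1)) (phasePlan N q j) := by
  have hunits : N * (q j : ℕ) ≤ (N - N / 2) * (2 * q j) := by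
    rw [← mul_assoc]
    exact Nat.mul_le_mul_right _ (by omega)
  rw [phaseStart_succ]
  refine (fits_gridPlan_replicate_unitJob _ _ hunits).append_of_compatible
    (fits_gridPlan_one ?_ ?_ (by simpa using N.div_le_self 2)) fun e he e' he' => Or.inl ?_
  · intro J hJ
    rw [List.eq_of_mem_replicate hJ]
    rfl
  · intro J hJ
    rw [List.eq_of_mem_replicate hJ, longJob_workload]
    simp
  · obtain ⟨u, -, rfl⟩ := List.mem_mapIdx.1 he
    obtain ⟨v, hv, rfl⟩ := List.mem_mapIdx.1 he'
    rw [List.length_replicate] at hv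
    simp only [Nat.div_one, zero_add]
    exact (hv.trans_le (Nat.le_add_right _ _)).ne'

theorem fits_phasesPlan (k : ℕ) : Fits N 0 (phaseStart q k) (phasesPlan N q k) := by
  have h := Fits.flatMap_range (k := k) monotone_phaseStart fun j _ =>
    fits_phasePlan (N := N) (q := q) j
  simpa [phasesPlan] using h

theorem Instance.Continues.phases_of_le {ω : Instance} {i k : ℕ} (hik : i ≤ k)
    (h : ω.Continues (phases N q k) (phaseStart q k)) :
    ω.Continues (phases N q i) (phaseStart q i) := by
  induction k, hik using Nat.le_induction with
  | base => exact h
  | succ k _ ih =>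
    rw [phases_succ] at h
    exact ih (h.of_append (fun J hJ => (release_of_mem_phase hJ).ge)
      (monotone_phaseStart k.le_succ))

end

section

variable {q : ℕ → ℕ+} {ω : Instance} {σ : Schedule N} {i j k : ℕ}

theorem le_three_mul_half (hN : 2 ≤ N) : (N : ℝ) ≤ 3 * (N / 2 : ℕ) := by
  exact_mod_cast by omega

theorem le_arrivals_phase {l : List Job} (hl : phase N q j <+ l) {θ t : ℝ}
    (hθ : 2 * (q j : ℕ) ≤ θ) (ht : phaseStart q j < t) :
    N * (q j : ℕ) + (N / 2 : ℕ) * (2 * (q j : ℕ)) ≤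
      arrivals l (Set.Iic θ) (phaseStart q j) t := by
  rw [← sum_headSize_phase]
  refine sum_headSize_le_arrivals hl fun J hJ => ⟨?_, ?_⟩
  · rw [release_of_mem_phase hJ]
    exact ⟨le_rfl, ht⟩
  · rcases eq_of_mem_phase hJ with rfl | rfl
    · have hq : (1 : ℝ) ≤ (q j : ℕ) := by exact_mod_cast (q j).pos
      simpa using by linarith
    · exact hθ

theorem card_arrived_Ioc_le {t : ℝ} (h : ω.Continues (phases N q (i + 1)) t)
    (hq : ∀ j < i, q i < q j) : #(ω.arrived (Set.Ioc 1 (2 * (q i : ℕ))) t) ≤ N / 2 := by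
  classical
  obtain ⟨Y, hω, hY⟩ := h
  rw [ω.card_arrived, hω, phases_succ, phase, List.countP_append, List.countP_append,
    List.countP_append, List.countP_eq_zero.2, List.countP_eq_zero.2,
    List.countP_eq_zero (l := Y) |>.2, zero_add, zero_add, add_zero]
  · exact List.countP_le_length.trans_eq List.length_replicate
  · intro J hJ
    simp [(hY J hJ).not_gt]
  · intro J hJ
    rw [List.eq_of_mem_replicate hJ]
    simp
  · intro J hJ
    obtain ⟨j, hj, rfl | rfl⟩ := exists_of_mem_phases hJ
    · simp
    · have hlt : ((q i : ℕ) : ℝ) < (q j : ℕ) := by exact_mod_cast hq j hj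
      simp [longJob_headSize, hlt.not_ge]

theorem Feasible.backlog_sub_le_of_phase (hσ : Feasible ω σ) (hN : 2 ≤ N)
    (hω : phase N q j <+ ω.jobs) {θ : ℝ} (hθ : 2 * (q j : ℕ) ≤ θ) :
    backlog ω σ (Set.Iic θ) (phaseStart q j) - N * (q j : ℕ) / 3 ≤
      backlog ω σ (Set.Iic θ) (phaseStart q (j + 1)) := by
  have hlt : (phaseStart q j : ℝ) < phaseStart q (j + 1) := by
    exact_mod_cast by simp [phaseStart_succ]
  have hbacklog := hσ.backlog_add_arrivals_le (Set.Iic θ) (phaseStart q j).cast_nonneg hlt.le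
  have harrivals := le_arrivals_phase hω hθ hlt
  have hhalf := mul_le_mul_of_nonneg_right (le_three_mul_half hN) (q j : ℕ).cast_nonneg (α := ℝ)
  rw [phaseStart_succ] at *
  push_cast at *
  linarith

theorem Feasible.le_backlog_mid_phase (hσ : Feasible ω σ) (hω : phase N q j <+ ω.jobs) :
    (N / 2 : ℕ) * (2 * (q j : ℕ)) ≤
      backlog ω σ (Set.Iic (2 * (q j : ℕ))) (phaseStart q j + q j : ℕ) := by
  have hlt : (phaseStart q j : ℝ) < (phaseStart q j + q j : ℕ) := by exact_mod_cast by simp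
  have hbacklog := hσ.backlog_add_arrivals_le (Set.Iic (2 * (q j : ℕ)))
    (phaseStart q j).cast_nonneg hlt.le
  have harrivals := le_arrivals_phase hω le_rfl hlt
  have hnonneg := hσ.backlog_nonneg (Set.Iic (2 * (q j : ℕ))) (phaseStart q j)
  push_cast at *
  linarith

theorem Feasible.le_backlog_of_backlog_mid_lt (hσ : Feasible ω σ) (hN : 2 ≤ N)
    (hω : ω.Continues (phases N q (i + 1)) (phaseStart q (i + 1))) (hq : ∀ j < i, q i < q j)
    (hunit : backlog ω σ (Set.Iic 1) (phaseStart q i + q i : ℕ) < N * (q i : ℕ) / 12) :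
    N * (q i : ℕ) / 4 ≤ backlog ω σ (Set.Iic (2 * (q i : ℕ))) (phaseStart q (i + 1)) := by
  have hq1 : (1 : ℝ) ≤ (q i : ℕ) := by exact_mod_cast (q i).pos
  have hhalf := mul_le_mul_of_nonneg_right (le_three_mul_half hN) (q i : ℕ).cast_nonneg (α := ℝ)
  have hend : (phaseStart q (i + 1) : ℝ) - (phaseStart q i + q i : ℕ) = (q i : ℕ) := by
    rw [phaseStart_succ]
    push_cast
    ring
  have hle : ((phaseStart q i + q i : ℕ) : ℝ) ≤ phaseStart q (i + 1) := by linarith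
  have htotal := hσ.le_backlog_mid_phase
    ((phases_succ (N := N) (q := q) i ▸ List.sublist_append_right _ _).trans hω.sublist)
  have hsplit : backlog ω σ (Set.Iic (2 * (q i : ℕ))) (phaseStart q i + q i : ℕ) =
      backlog ω σ (Set.Iic 1) (phaseStart q i + q i : ℕ) +
        backlog ω σ (Set.Ioc 1 (2 * (q i : ℕ))) (phaseStart q i + q i : ℕ) := by
    rw [← Set.Iic_union_Ioc_eq_Iic (by linarith : (1 : ℝ) ≤ 2 * (q i : ℕ))]
    exact backlog_union (Set.disjoint_left.2 fun x hx hx' => hx'.1.not_ge hx)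
  have hcard : (#(ω.arrived (Set.Ioc 1 (2 * (q i : ℕ))) (phaseStart q i + q i : ℕ)) : ℝ) *
      (q i : ℕ) ≤ (N / 2 : ℕ) * (q i : ℕ) := by
    gcongr
    exact card_arrived_Ioc_le (hω.mono hle) hq
  have hlong := hσ.backlog_sub_card_mul_le (Set.Ioc 1 (2 * (q i : ℕ)))
    (phaseStart q i + q i : ℕ).cast_nonneg hle
  rw [hend] at hlong
  calc N * (q i : ℕ) / 4 ≤ backlog ω σ (Set.Ioc 1 (2 * (q i : ℕ))) (phaseStart q (i + 1)) := by
        linarith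
    _ ≤ backlog ω σ (Set.Iic (2 * (q i : ℕ))) (phaseStart q (i + 1)) :=
        hσ.backlog_mono (fun x hx => hx.2) _

theorem lt_of_decay (hdecay : ∀ j, j + 1 < k → 8 * q (j + 1) ≤ q j) (hij : i < j) (hjk : j < k) :
    q j < q i := by
  have hstep (j : ℕ) (h : j + 1 < k) : q (j + 1) < q j := by
    have hpos := (q (j + 1)).pos
    have h8 : 8 * (q (j + 1) : ℕ) ≤ q j := by exact_mod_cast hdecay j h
    exact PNat.coe_lt_coe _ _ |>.1 (by omega)
  induction j, Nat.succ_le_of_lt hij using Nat.le_induction with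
  | base => exact hstep i hjk
  | succ j hj ih => exact (hstep j hjk).trans (ih hj (by omega))

/-- The constant is `21 = 3 * 7`: phase `j` costs the backlog at most `N * q j / 3`, and
`1 / 8 + 1 / 64 + ⋯ = 1 / 7`. -/
theorem Feasible.le_backlog_phaseStart_succ (hσ : Feasible ω σ) (hN : 2 ≤ N)
    (hω : ω.Continues (phases N q k) (phaseStart q k))
    (hdecay : ∀ j, j + 1 < k → 8 * q (j + 1) ≤ q j)
    (hunit : backlog ω σ (Set.Iic 1) (phaseStart q i + q i : ℕ) < N * (q i : ℕ) / 12)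
    (hij : i ≤ j) (hjk : j < k) :
    N * (q i : ℕ) / 4 - N * ((q i : ℕ) - (q j : ℕ)) / 21 ≤
      backlog ω σ (Set.Iic (2 * (q i : ℕ))) (phaseStart q (j + 1)) := by
  induction j, hij using Nat.le_induction with
  | base =>
    have hend := hσ.le_backlog_of_backlog_mid_lt hN (hω.phases_of_le hjk)
      (fun j hj => lt_of_decay hdecay hj hjk) hunit
    simpa using hend
  | succ j hij ih =>
    have hle : ((q (j + 1) : ℕ) : ℝ) ≤ (q i : ℕ) := by
      exact_mod_cast (lt_of_decay hdecay (Nat.lt_succ_of_le hij) hjk).le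
    have hphase : phase N q (j + 1) <+ ω.jobs :=
      (phases_succ (N := N) (q := q) (j + 1) ▸ List.sublist_append_right _ _).trans
        (hω.phases_of_le hjk).sublist
    have hloss := hσ.backlog_sub_le_of_phase hN hphase (mul_le_mul_of_nonneg_left hle zero_le_two)
    have hcoeff : (q (j + 1) : ℕ) / 3 ≤ (((q j : ℕ) : ℝ) - (q (j + 1) : ℕ)) / 21 := by
      have h8 : (8 * (q (j + 1) : ℕ) : ℝ) ≤ (q j : ℕ) := by exact_mod_cast hdecay j hjk
      linarith
    have hscaled := mul_le_mul_of_nonneg_left hcoeff N.cast_nonneg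
    linarith [ih (by omega)]

theorem Feasible.le_backlog_phaseStart (hσ : Feasible ω σ) (hN : 2 ≤ N)
    (hω : ω.Continues (phases N q k) (phaseStart q k))
    (hdecay : ∀ j, j + 1 < k → 8 * q (j + 1) ≤ q j)
    (hunit : backlog ω σ (Set.Iic 1) (phaseStart q i + q i : ℕ) < N * (q i : ℕ) / 12)
    (hik : i < k) :
    N * (q i : ℕ) / 6 ≤ backlog ω σ (Set.Iic (2 * (q i : ℕ))) (phaseStart q k) := by
  obtain ⟨j, rfl⟩ := Nat.exists_eq_add_one_of_ne_zero (Nat.ne_zero_of_lt hik)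
  have h := hσ.le_backlog_phaseStart_succ hN hω hdecay hunit (Nat.le_of_lt_succ hik) j.lt_succ_self
  have hi : (0 : ℝ) ≤ N * (q i : ℕ) := by positivity
  have hj : (0 : ℝ) ≤ N * (q j : ℕ) := by positivity
  linarith

end

theorem sum_inv_le {θ : ℕ → ℝ} {k : ℕ} (hpos : ∀ i ≤ k, 0 < θ i)
    (hdecay : ∀ i < k, 2 * θ (i + 1) ≤ θ i) :
    ∑ i ∈ Finset.range (k + 1), (θ i)⁻¹ ≤ 2 / θ k := by
  induction k with
  | zero =>
    rw [Finset.sum_range_one, div_eq_mul_inv]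
    linarith [inv_pos.2 (hpos 0 le_rfl)]
  | succ k ih =>
    have hk := hpos (k + 1) le_rfl
    rw [Finset.sum_range_succ]
    calc ∑ i ∈ Finset.range (k + 1), (θ i)⁻¹ + (θ (k + 1))⁻¹ ≤ 2 / θ k + (θ (k + 1))⁻¹ := by
          gcongr
          exact ih (fun i hi => hpos i (by omega)) fun i hi => hdecay i (by omega)
      _ ≤ 2 / (2 * θ (k + 1)) + (θ (k + 1))⁻¹ := by
          gcongr
          exact hdecay k k.lt_succ_self
      _ = 2 / θ (k + 1) := by
          field_simp
          norm_num

theorem sum_inv_filter_le {θ : ℕ → ℝ} {k : ℕ} (hpos : ∀ i < k, 0 < θ i)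
    (hdecay : ∀ i, i + 1 < k → 2 * θ (i + 1) ≤ θ i) {s : ℝ} (hs : 0 < s) :
    ∑ i ∈ Finset.range k with s ≤ θ i, (θ i)⁻¹ ≤ 2 / s := by
  induction k with
  | zero => simpa using by positivity
  | succ k ih =>
    rcases le_or_gt s (θ k) with h | h
    · calc ∑ i ∈ Finset.range (k + 1) with s ≤ θ i, (θ i)⁻¹
          ≤ ∑ i ∈ Finset.range (k + 1), (θ i)⁻¹ :=
            Finset.sum_le_sum_of_subset_of_nonneg (Finset.filter_subset _ _) fun i hi _ =>
              (inv_pos.2 (hpos i (Finset.mem_range.1 hi))).le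
        _ ≤ 2 / θ k := sum_inv_le (fun i hi => hpos i (by omega)) fun i hi => hdecay i (by omega)
        _ ≤ 2 / s := by gcongr
    · rw [Finset.range_add_one, Finset.filter_insert, if_neg h.not_ge]
      exact ih (fun i hi => hpos i (by omega)) fun i hi => hdecay i (by omega)

theorem Feasible.le_card_pending_of_phases {ω : Instance} {σ : Schedule N} {q : ℕ → ℕ+} {k L : ℕ}
    (hσ : Feasible ω σ) (hN : 2 ≤ N)
    (hω : ω.Continues (phases N q k ++ stream N (phaseStart q k) L) (phaseStart q k + L : ℕ))
    (hdecay : ∀ j, j + 1 < k → 8 * q (j + 1) ≤ q j)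
    (hunit : ∀ i < k,
      backlog ω σ (Set.Iic 1) (phaseStart q i + q i : ℕ) < N * (q i : ℕ) / 12)
    {l : ℕ} (hl : l ≤ L) : N * k / 24 ≤ (#(pending ω σ (phaseStart q k + l : ℕ)) : ℝ) := by
  have hphases : ω.Continues (phases N q k) (phaseStart q k) :=
    hω.of_append (fun J hJ => (releasedWithin_stream.mem_Icc J hJ).1) (by simp)
  have hstream : stream N (phaseStart q k) l <+ ω.jobs :=
    (stream_sublist le_rfl (by omega)).trans ((List.sublist_append_right _ _).trans hω.sublist)
  have hbacklog (i : ℕ) (hi : i ∈ Finset.range k) : (N / 12 : ℝ) ≤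
      backlog ω σ (Set.Iic (2 * (q i : ℕ))) (phaseStart q k + l : ℕ) / (2 * (q i : ℕ)) := by
    have hi' := Finset.mem_range.1 hi
    have hq : (1 : ℝ) ≤ (q i : ℕ) := by exact_mod_cast (q i).pos
    rw [le_div_iff₀ (by linarith)]
    calc (N / 12 : ℝ) * (2 * (q i : ℕ)) = N * (q i : ℕ) / 6 := by ring
      _ ≤ backlog ω σ (Set.Iic (2 * (q i : ℕ))) (phaseStart q k) :=
        hσ.le_backlog_phaseStart hN hphases hdecay (hunit i hi') hi'
      _ ≤ _ := hσ.backlog_le_backlog_of_stream (Set.mem_Iic.2 (by linarith)) hstream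
  have hpos (i : ℕ) : (0 : ℝ) < 2 * (q i : ℕ) := by
    have := (q i).pos
    positivity
  have hsum := hσ.sum_backlog_Iic_div_le (k := k) (θ := fun i => 2 * (q i : ℕ))
    (fun s hs => sum_inv_filter_le (fun i _ => hpos i) (fun i hi => ?_) hs)
    (phaseStart q k + l : ℕ)
  · have hcard := Finset.card_nsmul_le_sum _ _ _ hbacklog
    rw [Finset.card_range, nsmul_eq_mul] at hcard
    linarith
  · have h8 : (8 * (q (i + 1) : ℕ) : ℝ) ≤ (q i : ℕ) := by exact_mod_cast hdecay i hi
    linarith [hpos (i + 1)]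

theorem two_mul_mul_eight_pow_le (k : ℕ) : 2 * (k * 8 ^ (k - 1)) ≤ 16 ^ k := by
  cases k with
  | zero => simp
  | succ k =>
    calc 2 * ((k + 1) * 8 ^ k) ≤ 2 * (2 ^ (k + 1) * 8 ^ k) := by
          gcongr
          exact Nat.lt_two_pow_self.le
      _ ≤ 2 ^ (k + 1) * 8 ^ (k + 1) := by
          rw [pow_succ 8 k]
          linarith [Nat.zero_le (2 ^ (k + 1) * 8 ^ k)]
      _ = 16 ^ (k + 1) := (mul_pow 2 8 _).symm

theorem sixteen_pow_floor_log_le {α : ℝ} (hα : 1 ≤ α) :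
    (16 : ℝ) ^ ⌊Real.log α / 3⌋₊ ≤ α := by
  have hlog16 : Real.log 16 ≤ 3 := by
    rw [show (16 : ℝ) = 2 ^ 4 by norm_num, Real.log_pow]
    norm_num
    linarith [Real.log_two_lt_d9]
  rw [Real.pow_le_iff_le_log (by norm_num) (by linarith)]
  calc ⌊Real.log α / 3⌋₊ * Real.log 16 ≤ Real.log α / 3 * 3 :=
        mul_le_mul (Nat.floor_le (div_nonneg (Real.log_nonneg hα) zero_le_three)) hlog16
          (Real.log_nonneg (by norm_num)) (div_nonneg (Real.log_nonneg hα) zero_le_three)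
    _ = Real.log α := by ring

namespace OnlineAlgorithm

variable (A : OnlineAlgorithm N) {α β : ℝ} {q : ℕ → ℕ+} {i k : ℕ}

theorem div_le_competitiveRatio_of_le_backlog_mid (hN : 0 < N) (hα : 1 ≤ α) (hβ : 0 ≤ β)
    (hβα : β ≤ α) (hq : ∀ j ≤ i, 2 * (q j : ℕ) ≤ α) {ω : Instance}
    (hω : ω.Continues (phases N q (i + 1)) (phaseStart q i + q i : ℕ)) {B : ℝ}
    (hB : B ≤ backlog ω (A.schedule ω) (Set.Iic 1) (phaseStart q i + q i : ℕ)) :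
    ((B / (2 * N) : ℝ) : EReal) ≤ A.competitiveRatio α β := by
  let T := phaseStart q i + q i
  let X := phasesPlan N q i ++
    gridPlan (List.replicate (N * q i) (unitJob (phaseStart q i))) (phaseStart q i) 1 0 (q i)
  have hT : (phaseStart q i : ℝ) ≤ T := by simp [T]
  have hXD : X.map Entry.job ++ List.replicate (N / 2) (longJob q i) = phases N q (i + 1) := by
    simp [X, phases_succ, phase]
  refine A.div_le_competitiveRatio_of_pending (X := X)
    (D := List.replicate (N / 2) (longJob q i)) (T := T) (K := T) hN hα hβ hβα
    ((fits_phasesPlan i).append (fits_gridPlan_replicate_unitJob _ _ (by simp))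
      (Nat.cast_nonneg _) hT) ?_ ?_ (by simpa using N.div_le_self 2) fun L ω' hω' t hlt htL => ?_
  · rw [hXD, phases_succ]
    exact (releasedWithin_phases i).append ((releasedWithin_phase i).mono le_rfl hT)
      (Nat.cast_nonneg _) hT
  · rw [hXD]
    exact admissible_of_mem_phases hα fun j hj => hq j (Nat.le_of_lt_succ hj)
  rw [hXD] at hω'
  obtain ⟨l, rfl⟩ := Nat.exists_eq_add_of_le hlt.le
  have hstream : stream N T l <+ ω'.jobs :=
    (stream_sublist le_rfl htL).trans ((List.sublist_append_right _ _).trans hω'.sublist)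
  have hmid : ω'.Continues (phases N q (i + 1)) T :=
    hω'.of_append (fun J hJ => (releasedWithin_stream.mem_Icc J hJ).1) (by simp)
  calc B ≤ backlog ω' (A.schedule ω') (Set.Iic 1) T := hmid.backlog_eq hω A _ ▸ hB
    _ ≤ backlog ω' (A.schedule ω') (Set.Iic 1) (T + l : ℕ) :=
        (A.feasible ω').backlog_le_backlog_of_stream (by simp) hstream
    _ ≤ #(pending ω' (A.schedule ω') (T + l : ℕ)) := by
        simpa using (A.feasible ω').backlog_Iic_le zero_le_one (T + l : ℕ)

theorem div_le_competitiveRatio_of_backlog_mid_lt (hN : 2 ≤ N) (hα : 1 ≤ α) (hβ : 0 ≤ β)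
    (hβα : β ≤ α) (hq : ∀ j < k, 2 * (q j : ℕ) ≤ α)
    (hdecay : ∀ j, j + 1 < k → 8 * q (j + 1) ≤ q j)
    (hunit : ∀ i < k, ∀ ω : Instance,
      ω.Continues (phases N q (i + 1)) (phaseStart q i + q i : ℕ) →
        backlog ω (A.schedule ω) (Set.Iic 1) (phaseStart q i + q i : ℕ) < N * (q i : ℕ) / 12) :
    ((N * k / 24 / (2 * N) : ℝ) : EReal) ≤ A.competitiveRatio α β := by
  refine A.div_le_competitiveRatio_of_pending (X := phasesPlan N q k) (D := [])
    (T := phaseStart q k) (K := phaseStart q k) (by omega) hα hβ hβα (fits_phasesPlan k) ?_ ?_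
    (by simp) fun L ω hω t hlt htL => ?_
  · simpa using releasedWithin_phases k
  · simpa using admissible_of_mem_phases hα hq
  simp only [map_job_phasesPlan, List.append_nil] at hω
  have hphases : ω.Continues (phases N q k) (phaseStart q k) :=
    hω.of_append (fun J hJ => (releasedWithin_stream.mem_Icc J hJ).1) (by simp)
  obtain ⟨l, rfl⟩ := Nat.exists_eq_add_of_le hlt.le
  refine (A.feasible ω).le_card_pending_of_phases hN hω hdecay (fun i hi => ?_)
    (Nat.le_of_add_le_add_left htL)
  refine hunit i hi ω ((hphases.phases_of_le hi).mono ?_)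
  rw [phaseStart_succ]
  exact Nat.cast_le.2 (by omega)

theorem div_le_competitiveRatio_of_decay (hN : 2 ≤ N) (hα : 1 ≤ α) (hβ : 0 ≤ β) (hβα : β ≤ α)
    (hq : ∀ j < k, 2 * (q j : ℕ) ≤ α) (hdecay : ∀ j, j + 1 < k → 8 * q (j + 1) ≤ q j)
    (hk : ∀ j < k, k ≤ q j) : ((k / 48 : ℝ) : EReal) ≤ A.competitiveRatio α β := by
  have hN0 : (2 * N : ℝ) ≠ 0 := by exact_mod_cast (by omega : 2 * N ≠ 0)
  by_cases hunit : ∃ i < k, ∃ ω : Instance,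
      ω.Continues (phases N q (i + 1)) (phaseStart q i + q i : ℕ) ∧
        N * (q i : ℕ) / 12 ≤
          backlog ω (A.schedule ω) (Set.Iic 1) (phaseStart q i + q i : ℕ)
  · obtain ⟨i, hi, ω, hω, hB⟩ := hunit
    refine (EReal.coe_le_coe_iff.2 ?_).trans (A.div_le_competitiveRatio_of_le_backlog_mid
      (by omega) hα hβ hβα (fun j hj => hq j (hj.trans_lt hi)) hω hB)
    have hki : (k : ℝ) ≤ (q i : ℕ) := by exact_mod_cast hk i hi
    calc (k / 48 : ℝ) ≤ (q i : ℕ) / 24 := by linarith [k.cast_nonneg (α := ℝ)]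
      _ = N * (q i : ℕ) / 12 / (2 * N) := by
        rw [eq_div_iff hN0]
        ring
  · push Not at hunit
    refine (EReal.coe_le_coe_iff.2 (le_of_eq ?_)).trans
      (A.div_le_competitiveRatio_of_backlog_mid_lt hN hα hβ hβα hq hdecay hunit)
    rw [eq_div_iff hN0]
    ring

theorem log_div_le_competitiveRatio (hN : 2 ≤ N) (hα : 1 ≤ α) (hlogα : 3 ≤ Real.log α)
    (hβ : 0 ≤ β) (hβα : β ≤ α) :
    ((Real.log α / 288 : ℝ) : EReal) ≤ A.competitiveRatio α β := by
  have hk : 0 < ⌊Real.log α / 3⌋₊ := Nat.floor_pos.2 (by linarith)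
  have hlog : Real.log α / 3 < ⌊Real.log α / 3⌋₊ + 1 := Nat.lt_floor_add_one _
  have hpow : (16 : ℝ) ^ ⌊Real.log α / 3⌋₊ ≤ α := sixteen_pow_floor_log_le (by linarith)
  generalize ⌊Real.log α / 3⌋₊ = k at hk hlog hpow
  have hlongest : 2 * (k * 8 ^ (k - 1) : ℕ) ≤ α :=
    le_trans (by exact_mod_cast two_mul_mul_eight_pow_le k) hpow
  have hbound : Real.log α / 288 ≤ k / 48 := by
    have hk1 : (1 : ℝ) ≤ k := by exact_mod_cast hk
    linarith
  refine (EReal.coe_le_coe_iff.2 hbound).trans (A.div_le_competitiveRatio_of_decay hN hα hβ hβα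
    (q := fun j => ⟨k * 8 ^ (k - 1 - j), by positivity⟩) (fun j _ => ?_) (fun j hj => ?_)
    fun j _ => Nat.le_mul_of_pos_right _ (by positivity))
  · refine le_trans ?_ hlongest
    have hj : 8 ^ (k - 1 - j) ≤ 8 ^ (k - 1) := Nat.pow_le_pow_right (by norm_num) (Nat.sub_le _ _)
    exact_mod_cast Nat.mul_le_mul_left 2 (Nat.mul_le_mul_left k hj)
  · refine PNat.coe_le_coe _ _ |>.1 (le_of_eq ?_)
    change 8 * (k * 8 ^ (k - 1 - (j + 1))) = k * 8 ^ (k - 1 - j)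
    rw [show k - 1 - j = k - 1 - (j + 1) + 1 by omega, pow_succ]
    ring

end OnlineAlgorithm

theorem rpow_one_sub_le {ε β : ℝ} (hε : 0 < ε) (hβ : 0 ≤ β) (h : 1 ≤ β ∨ ε ≤ 1) :
    β ^ (1 - ε) ≤ 1 + β := by
  rcases le_total 1 β with hβ1 | hβ1
  · calc β ^ (1 - ε) ≤ β ^ (1 : ℝ) := Real.rpow_le_rpow_of_exponent_le hβ1 (by linarith)
      _ ≤ 1 + β := by
        rw [Real.rpow_one]
        linarith
  · rcases h with h | h
    · simp [le_antisymm hβ1 h]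
    · linarith [Real.rpow_le_one hβ hβ1 (sub_nonneg.2 h)]

end MPMS

end

theorem mainTheorem3_general {N : ℕ} (hN : 2 ≤ N) (A : MPMS.OnlineAlgorithm N)
    (hA : A.WorkConserving) {α β : ℝ} (hα : 1 ≤ α) (hβ : 0 ≤ β) (hβα : β ≤ α) :
    (((1 + Real.log α + β) / 300 : ℝ) : EReal) ≤ A.competitiveRatio α β := by
  by_contra! hlt
  have lt_of_le {x : ℝ} (hx : (x : EReal) ≤ A.competitiveRatio α β) :
      x < (1 + Real.log α + β) / 300 := EReal.coe_lt_coe_iff.1 (hx.trans_lt hlt)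
  have hone := lt_of_le (A.one_le_competitiveRatio hα hβ hβα)
  have hlog : Real.log α < 3 ∨ Real.log α / 288 < (1 + Real.log α + β) / 300 :=
    (lt_or_ge _ 3).imp_right fun h => lt_of_le (A.log_div_le_competitiveRatio hN hα h hβ hβα)
  have hbeta : β < 2 ∨ β / 6 < (1 + Real.log α + β) / 300 :=
    (lt_or_ge β 2).imp_right fun h =>
      lt_of_le (hA.div_six_le_competitiveRatio (by omega) h hβα)
  rcases hlog with hlog | hlog <;> rcases hbeta with hbeta | hbeta <;> linarith

theorem mainTheorem3 (ε : ℝ) (hε : 0 < ε) :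
    ∃ c : ℝ, 0 < c ∧
      ∀ (N : ℕ), 2 ≤ N →
      ∀ (A : MPMS.OnlineAlgorithm N), A.WorkConserving →
      ∀ (α β : ℝ), 1 ≤ α → 0 ≤ β → β ≤ α → (1 ≤ β ∨ ε ≤ 1) →
        ((c * (Real.log α + β ^ (1 - ε)) : ℝ) : EReal) ≤ A.competitiveRatio α β := by
  refine ⟨1 / 300, by norm_num, fun N hN A hA α β hα hβ hβα hε1 => ?_⟩
  refine (EReal.coe_le_coe_iff.2 ?_).trans (mainTheorem3_general hN A hA hα hβ hβα)
  linarith [MPMS.rpow_one_sub_le hε hβ hε1]
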